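/- **Proposition 3.1.** Let $d\in\{2,3\}$, $0<\lambda_{\min}\le\lambda_{\max}$ and $\kappa>0$. There is a constant $C>0$, depending only on $d,\lambda_{\min},\lambda_{\max},\kappa$, such that the following holds. Let $\Omega\subset\mathbb R^d$ be the interior of a convex polytope with non-empty interior, let $a\in L^\infty(\Omega)$ satisfy $\lambda_{\min}\le a(x)\le\lambda_{\max}$ for a.e. $x\in\Omega$, let $f\in L^2(\Omega)$, and let $u\in H^1_0(\Omega)$ be the weak solution of $-\operatorname{div}(a\nabla u)=f$ in $\Omega$, $u=0$ on $\partial\Omega$. Write $a(v,w)=\int_\Omega \nabla v\cdot a\nabla w\,dx$ and $\|v\|_a=a(v,v)^{1/2}$. Let $\overline\Omega=\bigcup_{i=1}^N D_i$ be a coarse mesh of size $H>0$, that is, a decomposition into convex polytopes $D_i$ with non-empty, pairwise disjoint interiors and diameters at most $\kappa H$ (for instance a square mesh of side $H$, with $\kappa=\sqrt2$), and let $\Gamma=\bigcup_{i=1}^N\partial D_i$. Let $\psi_1,\dots,\psi_m\in H^1_0(\Omega)$ be arbitrary, and let $\phi_1,\dots,\phi_n\in H^1_0(\Omega)$ be multi-scale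 basis functions, i.e. $-\operatorname{div}(a\nabla\phi_i)=0$ weakly in the interior of every $D_j$. Suppose that their traces on $\Gamma$ span the same subspace of $L^2(\Gamma)$ (with respect to $(d-1)$-dimensional Hausdorff measure): $$\operatorname{span}\{\phi_1|_\Gamma,\dots,\phi_n|_\Gamma\}=\operatorname{span}\{\psi_1|_\Gamma,\dots,\psi_m|_\Gamma\}.$$ Let $u_h\in V=\operatorname{span}\{\psi_i\}$ and $u_h^{MS}\in V^{MS}=\operatorname{span}\{\phi_i\}$ be the Galerkin solutions: $a(u_h,v)=\int_\Omega fv\,dx$ for all $v\in V$, and $a(u_h^{MS},v)=\int_\Omega fv\,dx$ for all $v\in V^{MS}$. Then $$\|u-u_h^{MS}\|_a^2\le\|u-u_h\|_a^2+C\|f\|_{L^2(\Omega)}^2H^2 .$$ Moreover, multi-scale bases are optimal up to $O(H)$ for fixed boundary conditions on $\Gamma$, in the sense that $$\|u-u_h^{MS}\|_a\le\|u-u_h\|_a+C\|f\|_{L^2(\Omega)}H .$$ -/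

import Mathlib

open MeasureTheory Filter Topology
open scoped ContDiff Gradient RealInnerProductSpace

namespace MultiscaleFEM

noncomputable section

/-- Euclidean space `ℝ^d`. -/
abbrev E (d : ℕ) : Type := EuclideanSpace ℝ (Fin d)

/-! ### Sobolev spaces -/

/-- `C_c^∞(U)`: smooth functions with compact support contained in `U`. -/
structure IsTestFun {d : ℕ} (U : Set (E d)) (η : E d → ℝ) : Prop where
  smooth : ContDiff ℝ ∞ η
  compact : HasCompactSupport η
  support_subset : tsupport η ⊆ U

/-- `G` is a square-integrable weak gradient of `w` on the open set `U`. -/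
structure HasWeakGrad {d : ℕ} (U : Set (E d)) (w : E d → ℝ) (G : E d → E d) : Prop where
  memLp : MemLp G 2 (volume.restrict U)
  integral_eq : ∀ η : E d → ℝ, IsTestFun U η →
    ∫ x in U, w x • ∇ η x = -∫ x in U, η x • G x

/-- `w ∈ H¹(U)`. -/
structure MemH1 {d : ℕ} (U : Set (E d)) (w : E d → ℝ) : Prop where
  memLp : MemLp w 2 (volume.restrict U)
  exists_weakGrad : ∃ G, HasWeakGrad U w G

open Classical in
/-- The weak gradient of `w ∈ H¹(U)`. It is unique up to equality almost everywhere on `U`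
(and is set to `0` for functions that have no square-integrable weak gradient). -/
def weakGrad {d : ℕ} (U : Set (E d)) (w : E d → ℝ) : E d → E d :=
  if h : ∃ G, HasWeakGrad U w G then h.choose else 0

/-- Convergence in the `H¹(U)` norm of smooth functions `η k` to `w ∈ H¹(U)`. -/
structure TendstoH1 {d : ℕ} (U : Set (E d)) (η : ℕ → E d → ℝ) (w : E d → ℝ) : Prop where
  value : Tendsto (fun k => eLpNorm (η k - w) 2 (volume.restrict U)) atTop (𝓝 0)
  grad : Tendsto (fun k => eLpNorm (∇ (η k) - weakGrad U w) 2 (volume.restrict U)) atTop (𝓝 0)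

/-- `w ∈ H¹₀(U)`, the closure of `C_c^∞(U)` in `H¹(U)`. -/
structure MemH10 {d : ℕ} (U : Set (E d)) (w : E d → ℝ) : Prop where
  memH1 : MemH1 U w
  approx : ∃ η : ℕ → E d → ℝ, (∀ k, IsTestFun U (η k)) ∧ TendstoH1 U η w

/-! ### The elliptic problem -/

/-- The bilinear form `a(u, v) = ∫_Ω ∇u · a ∇v`. -/
def energyForm {d : ℕ} (Ω : Set (E d)) (a : E d → ℝ) (u v : E d → ℝ) : ℝ :=
  ∫ x in Ω, a x * ⟪weakGrad Ω u x, weakGrad Ω v x⟫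

/-- The energy norm `‖u‖_a = a(u, u)^{1/2}`. -/
def energyNorm {d : ℕ} (Ω : Set (E d)) (a : E d → ℝ) (u : E d → ℝ) : ℝ :=
  √(energyForm Ω a u u)

/-- The norm of `L²(Ω)`. -/
def l2Norm {d : ℕ} (Ω : Set (E d)) (f : E d → ℝ) : ℝ :=
  (eLpNorm f 2 (volume.restrict Ω)).toReal

/-- `a ∈ L^∞(Ω)` is a uniformly elliptic scalar coefficient with values in `[lmin, lmax]`. -/
structure IsCoefficient {d : ℕ} (Ω : Set (E d)) (lmin lmax : ℝ) (a : E d → ℝ) : Prop where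
  measurable : AEStronglyMeasurable a (volume.restrict Ω)
  bounds : ∀ᵐ x ∂(volume.restrict Ω), a x ∈ Set.Icc lmin lmax

/-- `u ∈ H¹₀(Ω)` is the weak solution of `-div(a ∇u) = f` in `Ω`, `u = 0` on `∂Ω`. -/
structure IsWeakSolution {d : ℕ} (Ω : Set (E d)) (a f u : E d → ℝ) : Prop where
  memH10 : MemH10 Ω u
  weak_form : ∀ v : E d → ℝ, MemH10 Ω v → energyForm Ω a u v = ∫ x in Ω, f x * v x

/-- `uh` is the Galerkin solution in the trial space spanned by `ψ 0, …, ψ (m - 1)`. -/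
structure IsGalerkinSolution {d m : ℕ} (Ω : Set (E d)) (a f : E d → ℝ)
    (ψ : Fin m → E d → ℝ) (uh : E d → ℝ) : Prop where
  mem_span : uh ∈ Submodule.span ℝ (Set.range ψ)
  galerkin : ∀ v ∈ Submodule.span ℝ (Set.range ψ),
    energyForm Ω a uh v = ∫ x in Ω, f x * v x

/-! ### Coarse meshes, multi-scale functions and traces on the skeleton -/

/-- A (solid, closed) convex polytope: a polygon for `d = 2`, a polyhedron for `d = 3`. -/
structure IsConvexPolytope {d : ℕ} (P : Set (E d)) : Prop where
  eq_convexHull : ∃ s : Set (E d), s.Finite ∧ P = convexHull ℝ s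
  interior_nonempty : (interior P).Nonempty

/-- `D 0, …, D (N - 1)` are convex polytopes of diameter at most `r`, with disjoint interiors,
that decompose the (closed) polytope `P`. -/
structure IsCoarseMesh {d N : ℕ} (P : Set (E d)) (D : Fin N → Set (E d)) (r : ℝ) : Prop where
  polytope : ∀ i, IsConvexPolytope (D i)
  iUnion_eq : ⋃ i, D i = P
  disjoint : Pairwise fun i j => Disjoint (interior (D i)) (interior (D j))
  diam_le : ∀ i, Metric.diam (D i) ≤ r

/-- The coarse skeleton `Γ = ⋃ i, ∂ D i`. -/
def skeleton {d N : ℕ} (D : Fin N → Set (E d)) : Set (E d) := ⋃ i, frontier (D i)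

/-- Surface measure on `Γ`: the `(d-1)`-dimensional Hausdorff measure. -/
def surfaceMeasure {d : ℕ} (Γ : Set (E d)) : Measure (E d) :=
  (Measure.hausdorffMeasure ((d : ℝ) - 1)).restrict Γ

/-- `φ ∈ H¹₀(Ω)` is a multi-scale function: it is weakly `a`-harmonic, `-div(a ∇φ) = 0`,
in the interior of each coarse element. -/
structure IsMultiscale {d N : ℕ} (Ω : Set (E d)) (a : E d → ℝ) (D : Fin N → Set (E d))
    (φ : E d → ℝ) : Prop where
  memH10 : MemH10 Ω φ
  harmonic : ∀ i, ∀ η : E d → ℝ, IsTestFun (interior (D i)) η →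
    ∫ x in interior (D i), a x * ⟪weakGrad Ω φ x, ∇ η x⟫ = 0

/-- `g ∈ L²(Γ)` is the trace on `Γ` of `w ∈ H¹₀(Ω)`. The trace operator is the continuous
extension to `H¹₀(Ω)` of the restriction map `η ↦ η|_Γ`, `C_c^∞(Ω) → L²(Γ)`: its graph is the
closure of the graph of the restriction map. -/
def IsTrace {d : ℕ} (Ω Γ : Set (E d)) (w : E d → ℝ) (g : Lp ℝ 2 (surfaceMeasure Γ)) : Prop :=
  MemH10 Ω w ∧ ∃ η : ℕ → E d → ℝ, (∀ k, IsTestFun Ω (η k)) ∧ TendstoH1 Ω η w ∧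
    Tendsto (fun k => eLpNorm (η k - ⇑g) 2 (surfaceMeasure Γ)) atTop (𝓝 0)

/-- `span {ψ 0|_Γ, …, ψ (m - 1)|_Γ}`, a subspace of `L²(Γ)`. -/
def traceSpan {d m : ℕ} (Ω Γ : Set (E d)) (ψ : Fin m → E d → ℝ) :
    Submodule ℝ (Lp ℝ 2 (surfaceMeasure Γ)) :=
  Submodule.span ℝ {g | ∃ i, IsTrace Ω Γ (ψ i) g}

end

end MultiscaleFEM

namespace MultiscaleFEM

open scoped ENNReal

/-! ### Square-integrable functions -/

section L2

variable {α F : Type*} [MeasurableSpace α] {μ : Measure α} [NormedAddCommGroup F]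

/-! Choose `v` in the multi-scale space with the same trace on the skeleton as `u_h`, and put `z =
u_h - v`. Since `v` is a-harmonic in every cell and `z` vanishes on the skeleton, `a(z, v) = 0`.
Writing `u - v = (u - u_h) + z` and using `a(u, z) = ∫ f z` and `a(z, u_h) = a(z, z)` gives `‖u -
v‖_a² = ‖u - u_h‖_a² + 2 ∫ f z - ‖z‖_a²`. A Poincaré inequality on each cell bounds `‖z‖` in `L²` by
`2κH ‖∇z‖`, and Young's inequality absorbs the gradient into `-‖z‖_a²`, leaving `4κ²H²/λ_min ‖f‖²`.
Céa's lemma replaces `v` by the multi-scale Galerkin solution (`IsTrace.energyForm_error_le`,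
`IsGalerkinSolution.energyForm_error_le`).

The analytic work is in the two facts about `z`. Zero trace only means that `z` is an `H¹`-limit of
test functions `η_j` of `Ω` whose restrictions to the skeleton tend to zero in `L²`; `z` is never
identified with an element of `H¹₀` of a cell. Both facts rest on one slicing estimate
(`exists_setLIntegral_sq_le`): from each point of a cell follow a fixed direction to the boundary,
apply the fundamental theorem of calculus, and integrate over parallel lines. The boundary term
carries a constant depending on the polytope, but it disappears as `j → ∞`, so the resulting bound
depends only on the width of the set. Applied to a whole cell this is Poincaré; applied to a layer
along a face it is a Hardy-type bound `‖z‖ ≤ 2δ‖∇z‖` for layer width `δ`.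

Orthogonality (`ZeroTraceApprox.integral_inner_weakGrad_eq_zero`) tests the divergence-free field `G
= a∇φ` with `χ_ε z`, where `χ_ε` cuts off near the faces. The error `∫ (G · ∇χ_ε) z` carries a
factor `1/ε`, which the Hardy bound cancels; what remains is controlled by the norms of `G` on
shrinking layers, which tend to zero.

Polytopes are given as convex hulls, so a finite description by half-spaces is derived beforehand. A
trace inequality on hyperplanes shows that every `H¹₀` function has a trace on the skeleton. -/

theorem eLpNorm_two_sq (f : α → F) : eLpNorm f 2 μ ^ 2 = ∫⁻ x, ‖f x‖ₑ ^ 2 ∂μ := by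
  have := eLpNorm_nnreal_pow_eq_lintegral (μ := μ) (f := f) (p := 2) two_ne_zero
  simpa using this

/-- The `L²` seminorm is continuous. -/
theorem tendsto_eLpNorm_of_tendsto {g : ℕ → α → F} {g' : α → F}
    (hg : ∀ k, AEStronglyMeasurable (g k) μ) (hg' : MemLp g' 2 μ)
    (h : Tendsto (fun k => eLpNorm (g k - g') 2 μ) atTop (𝓝 0)) :
    Tendsto (fun k => eLpNorm (g k) 2 μ) atTop (𝓝 (eLpNorm g' 2 μ)) := by
  have hlow : Tendsto (fun k => eLpNorm g' 2 μ - eLpNorm (g k - g') 2 μ) atTop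
      (𝓝 (eLpNorm g' 2 μ)) := by
    simpa using ENNReal.Tendsto.sub tendsto_const_nhds h (Or.inl hg'.2.ne)
  have hup : Tendsto (fun k => eLpNorm g' 2 μ + eLpNorm (g k - g') 2 μ) atTop
      (𝓝 (eLpNorm g' 2 μ)) := by
    simpa using tendsto_const_nhds.add h
  refine tendsto_of_tendsto_of_tendsto_of_le_of_le hlow hup (fun k => ?_) (fun k => ?_)
  · refine tsub_le_iff_right.2 ?_
    calc eLpNorm g' 2 μ = eLpNorm (g k - (g k - g')) 2 μ := by simp
      _ ≤ _ := eLpNorm_sub_le (hg k) ((hg k).sub hg'.1) one_le_two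
  · calc eLpNorm (g k) 2 μ = eLpNorm (g' + (g k - g')) 2 μ := by simp
      _ ≤ _ := eLpNorm_add_le hg'.1 ((hg k).sub hg'.1) one_le_two

theorem tendsto_eLpNorm_add {f g : ℕ → α → F}
    (hf : ∀ k, AEStronglyMeasurable (f k) μ) (hg : ∀ k, AEStronglyMeasurable (g k) μ)
    (h1 : Tendsto (fun k => eLpNorm (f k) 2 μ) atTop (𝓝 0))
    (h2 : Tendsto (fun k => eLpNorm (g k) 2 μ) atTop (𝓝 0)) :
    Tendsto (fun k => eLpNorm (f k + g k) 2 μ) atTop (𝓝 0) := by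
  have := h1.add h2
  rw [add_zero] at this
  exact tendsto_of_tendsto_of_tendsto_of_le_of_le tendsto_const_nhds this
    (fun _ => zero_le) (fun k => eLpNorm_add_le (hf k) (hg k) one_le_two)

variable [InnerProductSpace ℝ F]

theorem integrable_inner_of_memLp {f g : α → F} (hf : MemLp f 2 μ) (hg : MemLp g 2 μ) :
    Integrable (fun x => ⟪f x, g x⟫) μ := by
  refine (L2.integrable_inner (𝕜 := ℝ) (hf.toLp f) (hg.toLp g)).congr ?_
  filter_upwards [hf.coeFn_toLp, hg.coeFn_toLp] with x h1 h2
  rw [h1, h2]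

/-- The Cauchy–Schwarz inequality in `L²`. -/
theorem abs_integral_inner_le {f g : α → F} (hf : MemLp f 2 μ) (hg : MemLp g 2 μ) :
    |∫ x, ⟪f x, g x⟫ ∂μ| ≤ (eLpNorm f 2 μ).toReal * (eLpNorm g 2 μ).toReal := by
  have h : ∫ x, ⟪f x, g x⟫ ∂μ = ⟪hf.toLp f, hg.toLp g⟫ := by
    rw [L2.inner_def]
    refine integral_congr_ae ?_
    filter_upwards [hf.coeFn_toLp, hg.coeFn_toLp] with x h1 h2
    rw [h1, h2]
  rw [h, ← Lp.norm_toLp f hf, ← Lp.norm_toLp g hg]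
  exact abs_real_inner_le_norm _ _

theorem integrable_smul_of_memLp {f : α → ℝ} {g : α → F} (hf : MemLp f 2 μ)
    (hg : MemLp g 2 μ) : Integrable (fun x => f x • g x) μ :=
  memLp_one_iff_integrable.1 (hg.smul hf)

theorem toReal_eLpNorm_two_sq {f : α → F} (hf : MemLp f 2 μ) :
    (eLpNorm f 2 μ).toReal ^ 2 = ∫ x, ‖f x‖ ^ 2 ∂μ := by
  rw [← Lp.norm_toLp f hf, ← real_inner_self_eq_norm_sq, L2.inner_def]
  refine integral_congr_ae ?_
  filter_upwards [hf.coeFn_toLp] with x h1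
  rw [h1, real_inner_self_eq_norm_sq]

/-- Limits of `L²` inner products. -/
theorem tendsto_integral_inner {f : α → F} {g : ℕ → α → F} {g' : α → F} (hf : MemLp f 2 μ)
    (hg : ∀ k, MemLp (g k) 2 μ) (hg' : MemLp g' 2 μ)
    (h : Tendsto (fun k => eLpNorm (g k - g') 2 μ) atTop (𝓝 0)) :
    Tendsto (fun k => ∫ x, ⟪f x, g k x⟫ ∂μ) atTop (𝓝 (∫ x, ⟪f x, g' x⟫ ∂μ)) := by
  rw [tendsto_iff_norm_sub_tendsto_zero]
  have h0 : Tendsto (fun k => (eLpNorm f 2 μ).toReal * (eLpNorm (g k - g') 2 μ).toReal) atTop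
      (𝓝 0) := by
    have := (ENNReal.tendsto_toReal ENNReal.zero_ne_top).comp h
    simpa using this.const_mul (eLpNorm f 2 μ).toReal
  refine squeeze_zero (fun _ => norm_nonneg _) (fun k => ?_) h0
  rw [← integral_sub (integrable_inner_of_memLp hf (hg k)) (integrable_inner_of_memLp hf hg'),
    Real.norm_eq_abs]
  simp_rw [← inner_sub_right]
  exact abs_integral_inner_le hf ((hg k).sub hg')

theorem tendsto_eLpNorm_const_smul {f : ℕ → α → F} (c : ℝ)
    (h1 : Tendsto (fun k => eLpNorm (f k) 2 μ) atTop (𝓝 0)) :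
    Tendsto (fun k => eLpNorm (c • f k) 2 μ) atTop (𝓝 0) := by
  have := ENNReal.Tendsto.const_mul (a := ‖c‖ₑ) h1 (Or.inr enorm_ne_top)
  rw [mul_zero] at this
  simpa only [eLpNorm_const_smul] using this

end L2

/-! ### Gradients -/

section Gradient

variable {F : Type*} [NormedAddCommGroup F] [InnerProductSpace ℝ F] [CompleteSpace F]
  {f g : F → ℝ} {x : F}

theorem gradient_add (hf : DifferentiableAt ℝ f x) (hg : DifferentiableAt ℝ g x) :
    ∇ (f + g) x = ∇ f x + ∇ g x := by
  simp [gradient, fderiv_add hf hg]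

theorem gradient_const_smul (hf : DifferentiableAt ℝ f x) (c : ℝ) :
    ∇ (c • f) x = c • ∇ f x := by
  simp [gradient, fderiv_const_smul hf c]

theorem gradient_mul (hf : DifferentiableAt ℝ f x) (hg : DifferentiableAt ℝ g x) :
    ∇ (f * g) x = f x • ∇ g x + g x • ∇ f x := by
  simp [gradient, fderiv_mul hf hg]

theorem continuous_gradient (hf : ContDiff ℝ 1 f) : Continuous (∇ f) :=
  (InnerProductSpace.toDual ℝ F).symm.continuous.comp (hf.continuous_fderiv one_ne_zero)

theorem hasCompactSupport_gradient (hf : HasCompactSupport f) : HasCompactSupport (∇ f) :=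
  (hf.fderiv ℝ).comp_left (g := (InnerProductSpace.toDual ℝ F).symm) (map_zero _)

theorem support_gradient_subset : Function.support (∇ f) ⊆ tsupport f := by
  intro x hx
  refine support_fderiv_subset ℝ (f := f) ?_
  intro h
  exact hx (by simp [gradient, h])

end Gradient

/-! ### Test functions -/

section TestFun

variable {d : ℕ} {U : Set (E d)} {η θ : E d → ℝ}

theorem IsTestFun.contDiff_one (h : IsTestFun U η) : ContDiff ℝ 1 η :=
  h.smooth.of_le (by exact_mod_cast le_top)

theorem IsTestFun.differentiable (h : IsTestFun U η) : Differentiable ℝ η :=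
  h.contDiff_one.differentiable one_ne_zero

theorem IsTestFun.gradient_continuous (h : IsTestFun U η) : Continuous (∇ η) :=
  continuous_gradient h.contDiff_one

theorem IsTestFun.memLp (h : IsTestFun U η) (V : Set (E d)) :
    MemLp η 2 (volume.restrict V) :=
  (h.smooth.continuous.memLp_of_hasCompactSupport h.compact).restrict V

theorem IsTestFun.memLp_gradient (h : IsTestFun U η) (V : Set (E d)) :
    MemLp (∇ η) 2 (volume.restrict V) :=
  (h.gradient_continuous.memLp_of_hasCompactSupport
    (hasCompactSupport_gradient h.compact)).restrict V

theorem isTestFun_zero : IsTestFun U 0 where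
  smooth := contDiff_const
  compact := HasCompactSupport.zero
  support_subset := by simp [tsupport]

theorem IsTestFun.add (h : IsTestFun U η) (h' : IsTestFun U θ) : IsTestFun U (η + θ) where
  smooth := h.smooth.add h'.smooth
  compact := h.compact.add h'.compact
  support_subset := (tsupport_add η θ).trans (Set.union_subset h.support_subset h'.support_subset)

theorem IsTestFun.const_smul (h : IsTestFun U η) (c : ℝ) : IsTestFun U (c • η) where
  smooth := h.smooth.const_smul c
  compact := h.compact.smul_left (f := fun _ => c)
  support_subset := (tsupport_smul_subset_right (fun _ => c) η).trans h.support_subset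

theorem IsTestFun.gradient_add (h : IsTestFun U η) (h' : IsTestFun U θ) :
    ∇ (η + θ) = ∇ η + ∇ θ :=
  funext fun x => MultiscaleFEM.gradient_add (h.differentiable x) (h'.differentiable x)

theorem IsTestFun.gradient_const_smul (h : IsTestFun U η) (c : ℝ) :
    ∇ (c • η) = c • ∇ η :=
  funext fun x => MultiscaleFEM.gradient_const_smul (h.differentiable x) c

end TestFun

/-! ### Weak gradients -/

section WeakGrad

variable {d : ℕ} {U : Set (E d)} {v w : E d → ℝ} {G G' : E d → E d}

/-- The fundamental lemma of the calculus of variations, applied to the difference. As `weakGrad` is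
an arbitrary choice, all its algebraic rules hold only almost everywhere and come from this
uniqueness. -/
theorem HasWeakGrad.ae_eq (hU : IsOpen U) (h : HasWeakGrad U w G) (h' : HasWeakGrad U w G') :
    G =ᵐ[volume.restrict U] G' := by
  have hsub := h.memLp.sub h'.memLp
  have hloc : LocallyIntegrableOn (G - G') U volume := by
    have : LocallyIntegrable (G - G') (volume.restrict U) := hsub.locallyIntegrable one_le_two
    intro x hx
    obtain ⟨s, hs, hint⟩ := this x
    refine ⟨s ∩ U, inter_mem (mem_nhdsWithin_of_mem_nhds hs) self_mem_nhdsWithin, ?_⟩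
    rwa [IntegrableOn, Measure.restrict_restrict' hU.measurableSet] at hint
  have := hU.ae_eq_zero_of_integral_contDiff_smul_eq_zero hloc (fun g g1 g2 g3 => by
    have ht : IsTestFun U g := ⟨g1, g2, g3⟩
    have e1 := h.integral_eq g ht
    have e2 := h'.integral_eq g ht
    have hz : ∀ x, x ∉ U → g x • (G - G') x = 0 := fun x hx => by
      rw [image_eq_zero_of_notMem_tsupport (fun hx' => hx (g3 hx')), zero_smul]
    rw [← setIntegral_eq_integral_of_forall_compl_eq_zero hz]
    simp only [Pi.sub_apply, smul_sub]
    rw [integral_sub (integrable_smul_of_memLp (ht.memLp U) h.memLp)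
      (integrable_smul_of_memLp (ht.memLp U) h'.memLp), sub_eq_zero]
    exact neg_injective (e1.symm.trans e2))
  refine (ae_restrict_iff' hU.measurableSet).2 ?_
  filter_upwards [this] with x hx hxU
  exact sub_eq_zero.1 (hx hxU)

theorem HasWeakGrad.add (h : HasWeakGrad U v G) (h' : HasWeakGrad U w G')
    (hv : MemLp v 2 (volume.restrict U)) (hw : MemLp w 2 (volume.restrict U)) :
    HasWeakGrad U (v + w) (G + G') where
  memLp := h.memLp.add h'.memLp
  integral_eq η hη := by
    simp only [Pi.add_apply, add_smul, smul_add]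
    rw [integral_add (integrable_smul_of_memLp hv (hη.memLp_gradient U))
        (integrable_smul_of_memLp hw (hη.memLp_gradient U)),
      integral_add (integrable_smul_of_memLp (hη.memLp U) h.memLp)
        (integrable_smul_of_memLp (hη.memLp U) h'.memLp), h.integral_eq η hη,
      h'.integral_eq η hη, neg_add]

theorem HasWeakGrad.const_smul (h : HasWeakGrad U w G) (c : ℝ) :
    HasWeakGrad U (c • w) (c • G) where
  memLp := h.memLp.const_smul c
  integral_eq η hη := by
    simp only [Pi.smul_apply, smul_eq_mul, mul_smul, smul_comm _ c]
    rw [integral_smul, integral_smul, h.integral_eq η hη, smul_neg]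

theorem hasWeakGrad_zero : HasWeakGrad U 0 0 where
  memLp := MemLp.zero
  integral_eq η hη := by simp

theorem MemH1.hasWeakGrad (h : MemH1 U w) : HasWeakGrad U w (weakGrad U w) := by
  rw [weakGrad, dif_pos h.exists_weakGrad]
  exact h.exists_weakGrad.choose_spec

theorem MemH1.memLp_weakGrad (h : MemH1 U w) : MemLp (weakGrad U w) 2 (volume.restrict U) :=
  h.hasWeakGrad.memLp

theorem memH1_zero : MemH1 U (0 : E d → ℝ) := ⟨MemLp.zero, 0, hasWeakGrad_zero⟩

theorem MemH1.add (hv : MemH1 U v) (hw : MemH1 U w) : MemH1 U (v + w) :=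
  ⟨hv.memLp.add hw.memLp, _, hv.hasWeakGrad.add hw.hasWeakGrad hv.memLp hw.memLp⟩

theorem MemH1.const_smul (hw : MemH1 U w) (c : ℝ) : MemH1 U (c • w) :=
  ⟨hw.memLp.const_smul c, _, hw.hasWeakGrad.const_smul c⟩

theorem weakGrad_add (hU : IsOpen U) (hv : MemH1 U v) (hw : MemH1 U w) :
    weakGrad U (v + w) =ᵐ[volume.restrict U] weakGrad U v + weakGrad U w :=
  (hv.add hw).hasWeakGrad.ae_eq hU (hv.hasWeakGrad.add hw.hasWeakGrad hv.memLp hw.memLp)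

theorem weakGrad_const_smul (hU : IsOpen U) (hw : MemH1 U w) (c : ℝ) :
    weakGrad U (c • w) =ᵐ[volume.restrict U] c • weakGrad U w :=
  (hw.const_smul c).hasWeakGrad.ae_eq hU (hw.hasWeakGrad.const_smul c)

theorem weakGrad_zero (hU : IsOpen U) :
    weakGrad U (0 : E d → ℝ) =ᵐ[volume.restrict U] 0 :=
  memH1_zero.hasWeakGrad.ae_eq hU hasWeakGrad_zero

variable {η θ : ℕ → E d → ℝ}

theorem TendstoH1.add (hU : IsOpen U) (hv : MemH1 U v) (hw : MemH1 U w)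
    (hη : ∀ k, IsTestFun U (η k)) (hθ : ∀ k, IsTestFun U (θ k))
    (h : TendstoH1 U η v) (h' : TendstoH1 U θ w) :
    TendstoH1 U (fun k => η k + θ k) (v + w) where
  value := by
    have := tendsto_eLpNorm_add (fun k => (((hη k).memLp U).sub hv.memLp).1)
      (fun k => (((hθ k).memLp U).sub hw.memLp).1) h.value h'.value
    refine this.congr fun k => ?_
    congr 1
    abel
  grad := by
    have := tendsto_eLpNorm_add (fun k => (((hη k).memLp_gradient U).sub hv.memLp_weakGrad).1)
      (fun k => (((hθ k).memLp_gradient U).sub hw.memLp_weakGrad).1) h.grad h'.grad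
    refine this.congr fun k => eLpNorm_congr_ae ?_
    filter_upwards [weakGrad_add hU hv hw] with x hx
    simp only [(hη k).gradient_add (hθ k), Pi.sub_apply, hx, Pi.add_apply]
    abel

theorem TendstoH1.const_smul (hU : IsOpen U) (hv : MemH1 U v)
    (hη : ∀ k, IsTestFun U (η k)) (h : TendstoH1 U η v) (c : ℝ) :
    TendstoH1 U (fun k => c • η k) (c • v) where
  value := by
    refine (tendsto_eLpNorm_const_smul c h.value).congr fun k => ?_
    rw [smul_sub]
  grad := by
    refine (tendsto_eLpNorm_const_smul c h.grad).congr fun k => eLpNorm_congr_ae ?_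
    filter_upwards [weakGrad_const_smul hU hv c] with x hx
    simp only [(hη k).gradient_const_smul c, Pi.sub_apply, hx, Pi.smul_apply, smul_sub]

theorem tendstoH1_zero (hU : IsOpen U) : TendstoH1 U (fun _ => 0) (0 : E d → ℝ) where
  value := by simp
  grad := by
    refine tendsto_const_nhds.congr fun k => ?_
    symm
    refine (eLpNorm_congr_ae (g := 0) ?_).trans eLpNorm_zero
    filter_upwards [weakGrad_zero hU] with x hx
    simp [gradient, hx]

/-- `H¹₀(U)` as a space of functions. -/
def h10 (U : Set (E d)) (hU : IsOpen U) : Submodule ℝ (E d → ℝ) where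
  carrier := {w | MemH10 U w}
  add_mem' := by
    rintro v w ⟨hv, η, hη, h⟩ ⟨hw, θ, hθ, h'⟩
    exact ⟨hv.add hw, _, fun k => (hη k).add (hθ k), h.add hU hv hw hη hθ h'⟩
  zero_mem' := ⟨memH1_zero, _, fun _ => isTestFun_zero, tendstoH1_zero hU⟩
  smul_mem' := by
    rintro c v ⟨hv, η, hη, h⟩
    exact ⟨hv.const_smul c, _, fun k => (hη k).const_smul c, h.const_smul hU hv hη c⟩

end WeakGrad

/-! ### The energy form -/

section Energy

variable {d : ℕ} {Ω : Set (E d)} {lmin lmax : ℝ} {a u v w : E d → ℝ}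

theorem IsCoefficient.memLp_smul (ha : IsCoefficient Ω lmin lmax a) {G : E d → E d}
    (hG : MemLp G 2 (volume.restrict Ω)) :
    MemLp (fun x => a x • G x) 2 (volume.restrict Ω) := by
  refine hG.of_le_mul (c := max |lmin| |lmax|) (ha.measurable.smul hG.1) ?_
  filter_upwards [ha.bounds] with x hx
  rw [norm_smul, Real.norm_eq_abs]
  gcongr
  exact abs_le_max_abs_abs hx.1 hx.2

theorem energyForm_eq_inner_smul :
    energyForm Ω a u v = ∫ x in Ω, ⟪a x • weakGrad Ω u x, weakGrad Ω v x⟫ := by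
  simp only [energyForm, real_inner_smul_left]

theorem energyForm_comm : energyForm Ω a u v = energyForm Ω a v u := by
  simp only [energyForm, real_inner_comm]

theorem energyForm_add_right (hΩ : IsOpen Ω) (ha : IsCoefficient Ω lmin lmax a)
    (hu : MemH1 Ω u) (hv : MemH1 Ω v) (hw : MemH1 Ω w) :
    energyForm Ω a u (v + w) = energyForm Ω a u v + energyForm Ω a u w := by
  simp only [energyForm_eq_inner_smul]
  rw [← integral_add (integrable_inner_of_memLp (ha.memLp_smul hu.memLp_weakGrad)
      hv.memLp_weakGrad) (integrable_inner_of_memLp (ha.memLp_smul hu.memLp_weakGrad)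
      hw.memLp_weakGrad)]
  refine integral_congr_ae ?_
  filter_upwards [weakGrad_add hΩ hv hw] with x hx
  rw [hx, Pi.add_apply, inner_add_right]

theorem energyForm_smul_right (hΩ : IsOpen Ω) (hv : MemH1 Ω v) (c : ℝ) :
    energyForm Ω a u (c • v) = c * energyForm Ω a u v := by
  simp only [energyForm_eq_inner_smul]
  rw [← integral_const_mul]
  refine integral_congr_ae ?_
  filter_upwards [weakGrad_const_smul hΩ hv c] with x hx
  rw [hx, Pi.smul_apply, real_inner_smul_right]

theorem energyForm_add_self (hΩ : IsOpen Ω) (ha : IsCoefficient Ω lmin lmax a)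
    (hv : MemH1 Ω v) (hw : MemH1 Ω w) :
    energyForm Ω a (v + w) (v + w) =
      energyForm Ω a v v + 2 * energyForm Ω a v w + energyForm Ω a w w := by
  rw [energyForm_add_right hΩ ha (hv.add hw) hv hw, energyForm_comm (u := v + w) (v := v),
    energyForm_comm (u := v + w) (v := w), energyForm_add_right hΩ ha hv hv hw,
    energyForm_add_right hΩ ha hw hv hw, energyForm_comm (u := w) (v := v)]
  ring

theorem energyForm_sub_right (hΩ : IsOpen Ω) (ha : IsCoefficient Ω lmin lmax a)
    (hu : MemH1 Ω u) (hv : MemH1 Ω v) (hw : MemH1 Ω w) :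
    energyForm Ω a u (v - w) = energyForm Ω a u v - energyForm Ω a u w := by
  have := energyForm_add_right hΩ ha hu hv (hw.const_smul (-1))
  rw [energyForm_smul_right hΩ hw, neg_one_smul, ← sub_eq_add_neg] at this
  linarith

theorem MemH1.sub (hv : MemH1 Ω v) (hw : MemH1 Ω w) : MemH1 Ω (v - w) := by
  simpa [sub_eq_add_neg] using hv.add (hw.const_smul (-1))

theorem energyForm_sub_left (hΩ : IsOpen Ω) (ha : IsCoefficient Ω lmin lmax a)
    (hu : MemH1 Ω u) (hv : MemH1 Ω v) (hw : MemH1 Ω w) :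
    energyForm Ω a (v - w) u = energyForm Ω a v u - energyForm Ω a w u := by
  rw [energyForm_comm, energyForm_sub_right hΩ ha hu hv hw, energyForm_comm (u := u),
    energyForm_comm (u := u)]

theorem energyForm_self_ge (ha : IsCoefficient Ω lmin lmax a) (hu : MemH1 Ω u) :
    lmin * (eLpNorm (weakGrad Ω u) 2 (volume.restrict Ω)).toReal ^ 2 ≤ energyForm Ω a u u := by
  rw [toReal_eLpNorm_two_sq hu.memLp_weakGrad, ← integral_const_mul, energyForm_eq_inner_smul]
  refine integral_mono_ae ?_ (integrable_inner_of_memLp (ha.memLp_smul hu.memLp_weakGrad)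
    hu.memLp_weakGrad) ?_
  · exact ((memLp_two_iff_integrable_sq_norm hu.memLp_weakGrad.1).1 hu.memLp_weakGrad).const_mul _
  · filter_upwards [ha.bounds] with x hx
    rw [real_inner_smul_left, real_inner_self_eq_norm_sq]
    gcongr
    exact hx.1

theorem energyForm_self_nonneg (hmin : 0 ≤ lmin) (ha : IsCoefficient Ω lmin lmax a)
    (hu : MemH1 Ω u) : 0 ≤ energyForm Ω a u u :=
  le_trans (by positivity) (energyForm_self_ge ha hu)

theorem energyNorm_sq (hmin : 0 ≤ lmin) (ha : IsCoefficient Ω lmin lmax a)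
    (hu : MemH1 Ω u) : energyNorm Ω a u ^ 2 = energyForm Ω a u u :=
  Real.sq_sqrt (energyForm_self_nonneg hmin ha hu)

end Energy

end MultiscaleFEM

namespace MultiscaleFEM

open scoped ENNReal

/-! ### Convex polytopes as intersections of half-spaces -/

section Polytope

variable {d : ℕ} {P : Set (E d)} {T : Finset (E d × ℝ)}

theorem IsConvexPolytope.convex (h : IsConvexPolytope P) : Convex ℝ P := by
  obtain ⟨s, -, rfl⟩ := h.eq_convexHull
  exact convex_convexHull ℝ s

theorem IsConvexPolytope.isCompact (h : IsConvexPolytope P) : IsCompact P := by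
  obtain ⟨s, hs, rfl⟩ := h.eq_convexHull
  exact hs.isCompact_convexHull ℝ

theorem IsConvexPolytope.closure_interior (h : IsConvexPolytope P) :
    closure (interior P) = P := by
  rw [h.convex.closure_interior_eq_closure_of_nonempty_interior h.interior_nonempty,
    h.isCompact.isClosed.closure_eq]

/-- The finite set `T` of pairs `(n, b)` describes `P` as the polytope with outer unit normals `n`
and offsets `b`: `P` lies in the half-spaces `⟪n, x⟫ ≤ b` and its interior is the
intersection of the open half-spaces. -/
structure IsHalfspaceDescription (P : Set (E d)) (T : Finset (E d × ℝ)) : Prop where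
  norm_eq : ∀ p ∈ T, ‖p.1‖ = 1
  inner_le : ∀ p ∈ T, ∀ x ∈ P, ⟪p.1, x⟫ ≤ p.2
  interior_eq : interior P = {x | ∀ p ∈ T, ⟪p.1, x⟫ < p.2}

/-- Hahn–Banach separates `x` from the open convex set `interior P`; the weak inequality passes to
its closure, which is `P`. -/
theorem IsConvexPolytope.exists_supporting (h : IsConvexPolytope P) {x : E d}
    (hx : x ∉ interior P) :
    ∃ n : E d, ‖n‖ = 1 ∧ ∀ y ∈ P, ⟪n, y⟫ ≤ ⟪n, x⟫ := by
  obtain ⟨f, hf⟩ := geometric_hahn_banach_open_point h.convex.interior isOpen_interior hx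
  set n₀ := (InnerProductSpace.toDual ℝ (E d)).symm f with hn₀
  have hf' : ∀ y, ⟪n₀, y⟫ = f y := fun y => by
    rw [hn₀, InnerProductSpace.toDual_symm_apply]
  have hne : n₀ ≠ 0 := by
    rintro h0
    obtain ⟨y, hy⟩ := h.interior_nonempty
    have := hf y hy
    rw [← hf', ← hf', h0] at this
    simp at this
  have hpos : 0 < ‖n₀‖ := norm_pos_iff.2 hne
  refine ⟨‖n₀‖⁻¹ • n₀, by rw [norm_smul, norm_inv, norm_norm, inv_mul_cancel₀ hpos.ne'], ?_⟩
  intro y hy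
  rw [real_inner_smul_left, real_inner_smul_left, hf', hf']
  refine mul_le_mul_of_nonneg_left ?_ (by positivity)
  rw [← h.closure_interior] at hy
  exact closure_minimal (s := interior P) (t := {z | f z ≤ f x}) (fun z hz => (hf z hz).le)
    (isClosed_le f.continuous continuous_const) hy

/-- A small step from `x` along `n` stays in `P` and strictly increases the inner product with `n`.
-/
theorem inner_lt_of_mem_interior {n : E d} {b : ℝ} (hn : n ≠ 0)
    (h : ∀ y ∈ P, ⟪n, y⟫ ≤ b) {x : E d} (hx : x ∈ interior P) : ⟪n, x⟫ < b := by
  have hc : Continuous fun ε : ℝ => x + ε • n := by fun_prop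
  have hev : ∀ᶠ ε in 𝓝 (0 : ℝ), x + ε • n ∈ P := by
    have := hc.tendsto 0
    simp only [zero_smul, add_zero] at this
    exact this.eventually (mem_interior_iff_mem_nhds.1 hx)
  obtain ⟨ε, hε, hpos⟩ := ((hev.filter_mono nhdsWithin_le_nhds).and
    (self_mem_nhdsWithin : Set.Ioi (0 : ℝ) ∈ 𝓝[>] 0)).exists
  have := h _ hε
  rw [inner_add_right, real_inner_smul_right, real_inner_self_eq_norm_sq] at this
  have h2 : 0 < ε * ‖n‖ ^ 2 := mul_pos hpos (by positivity)
  linarith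

/-- There may be infinitely many supporting half-spaces, but one for each set of generating points
lying on a common supporting hyperplane suffices. A boundary point is a convex combination of the
generating points on its supporting hyperplane, so any other supporting hyperplane through those
points contains it too. -/
theorem IsConvexPolytope.exists_halfspaceDescription (h : IsConvexPolytope P) :
    ∃ T, IsHalfspaceDescription P T := by
  classical
  obtain ⟨s, hs, hP⟩ := h.eq_convexHull
  let Q : Finset (E d) → E d × ℝ → Prop := fun t p =>
    ‖p.1‖ = 1 ∧ (∀ x ∈ P, ⟪p.1, x⟫ ≤ p.2) ∧ ∀ x ∈ t, ⟪p.1, x⟫ = p.2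
  -- A choice of one half-space for each contact set `t`, with a junk value when none exists.
  have hg : ∀ t, ∃ p, (∃ p', Q t p') → Q t p := fun t => by
    by_cases hp : ∃ p', Q t p'
    · obtain ⟨p', hp'⟩ := hp
      exact ⟨p', fun _ => hp'⟩
    · exact ⟨0, fun h' => absurd h' hp⟩
  choose g hg using hg
  set S := hs.toFinset
  let T := (S.powerset.filter fun t => ∃ p, Q t p).image g
  have hT : ∀ p ∈ T, ∃ t, Q t p := by
    intro p hp
    obtain ⟨t, ht, rfl⟩ := Finset.mem_image.1 hp
    exact ⟨t, hg t (Finset.mem_filter.1 ht).2⟩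
  have hsub : interior P ⊆ {x | ∀ p ∈ T, ⟪p.1, x⟫ < p.2} := by
    intro x hx p hp
    obtain ⟨t, h1, h2, -⟩ := hT p hp
    exact inner_lt_of_mem_interior (by rw [← norm_ne_zero_iff, h1]; exact one_ne_zero) h2 hx
  have hfront : ∀ x ∈ P, x ∉ interior P → ∃ p ∈ T, ⟪p.1, x⟫ = p.2 := by
    intro x hxP hx
    obtain ⟨n, hn, hle⟩ := h.exists_supporting hx
    have hsP : ∀ y ∈ S, y ∈ P := fun y hy => by
      rw [hP]; exact subset_convexHull ℝ s (hs.mem_toFinset.1 hy)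
    obtain ⟨w, hw0, hw1, hwx⟩ : ∃ w : E d → ℝ, (∀ y ∈ S, 0 ≤ w y) ∧ ∑ y ∈ S, w y = 1 ∧
        ∑ y ∈ S, w y • y = x := by
      have : x ∈ convexHull ℝ (S : Set (E d)) := by rwa [hs.coe_toFinset, ← hP]
      exact Finset.mem_convexHull'.1 this
    set t := S.filter fun y => ⟪n, y⟫ = ⟪n, x⟫ with ht
    have hQ : ∃ p, Q t p := ⟨(n, ⟪n, x⟫), hn, hle, fun y hy => (Finset.mem_filter.1 hy).2⟩
    -- The gaps are nonnegative and their weighted sum is zero because `x` is the barycentre; so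
    -- only points of `t` carry weight.
    have hwz : ∀ y ∈ S, w y * (⟪n, x⟫ - ⟪n, y⟫) = 0 := by
      refine (Finset.sum_eq_zero_iff_of_nonneg fun y hy =>
        mul_nonneg (hw0 y hy) (sub_nonneg.2 (hle y (hsP y hy)))).1 ?_
      simp only [mul_sub, Finset.sum_sub_distrib, ← Finset.sum_mul, hw1, one_mul]
      conv_lhs => enter [1]; rw [← hwx]
      rw [inner_sum, sub_eq_zero]
      exact Finset.sum_congr rfl fun y _ => by rw [real_inner_smul_right]
    refine ⟨g t, Finset.mem_image.2 ⟨t, Finset.mem_filter.2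
      ⟨Finset.mem_powerset.2 (Finset.filter_subset _ _), hQ⟩, rfl⟩, ?_⟩
    obtain ⟨-, -, h3⟩ := hg t hQ
    rw [← hwx, inner_sum]
    calc ∑ y ∈ S, ⟪(g t).1, w y • y⟫ = ∑ y ∈ S, w y * (g t).2 := by
          refine Finset.sum_congr rfl fun y hy => ?_
          rw [real_inner_smul_right]
          rcases mul_eq_zero.1 (hwz y hy) with h0 | h0
          · rw [h0, zero_mul, zero_mul]
          · rw [h3 y (Finset.mem_filter.2 ⟨hy, (sub_eq_zero.1 h0).symm⟩)]
      _ = (g t).2 := by rw [← Finset.sum_mul, hw1, one_mul]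
  refine ⟨T, fun p hp => (hT p hp).elim fun t ht => ht.1,
    fun p hp => (hT p hp).elim fun t ht => ht.2.1, hsub.antisymm ?_⟩
  have hconv : Convex ℝ {x : E d | ∀ p ∈ T, ⟪p.1, x⟫ < p.2} := by
    simp only [Set.ofPred_forall]
    exact convex_iInter₂ fun p _ => convex_halfSpace_lt (innerₛₗ ℝ p.1).isLinear p.2
  obtain ⟨x₀, hx₀⟩ := h.interior_nonempty
  -- The intersection of open half-spaces is connected, and `interior P` is open, nonempty and
  -- relatively closed in it, since at a point of `P` off the interior some constraint is an
  -- equality.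
  refine hconv.isPreconnected.subset_of_closure_inter_subset isOpen_interior
    ⟨x₀, hsub hx₀, hx₀⟩ fun z hz => ?_
  rw [h.closure_interior] at hz
  by_contra hzn
  obtain ⟨p, hp, hpz⟩ := hfront z hz.1 hzn
  exact (hz.2 p hp).ne hpz

theorem IsHalfspaceDescription.exists_inner_eq (hT : IsHalfspaceDescription P T)
    (hP : IsConvexPolytope P) {x : E d} (hx : x ∈ frontier P) :
    ∃ p ∈ T, ⟪p.1, x⟫ = p.2 := by
  rw [frontier, hP.isCompact.isClosed.closure_eq, hT.interior_eq] at hx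
  obtain ⟨hxP, hx⟩ := hx
  simp only [Set.mem_ofPred_eq, not_forall, not_lt] at hx
  obtain ⟨p, hp, hpx⟩ := hx
  exact ⟨p, hp, (hT.inner_le p hp x hxP).antisymm hpx⟩

/-- Moving from an interior point in any direction one meets the boundary, at a face that the
direction points out of. -/
theorem IsHalfspaceDescription.exists_exit (hT : IsHalfspaceDescription P T)
    (hP : IsConvexPolytope P) {x n : E d} (hn : n ≠ 0) (hx : x ∈ interior P) :
    ∃ s : ℝ, 0 < s ∧ (∀ τ ∈ Set.Ico 0 s, x + τ • n ∈ interior P) ∧ x + s • n ∈ frontier P ∧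
      ∃ p ∈ T, 0 < ⟪p.1, n⟫ ∧ ⟪p.1, x + s • n⟫ = p.2 := by
  classical
  have hxlt : ∀ p ∈ T, ⟪p.1, x⟫ < p.2 := by rwa [hT.interior_eq] at hx
  -- Otherwise the whole ray stays in `P`. If `P` lies in the ball of radius `R`, a displacement of
  -- length `2R + 1` is impossible.
  have hne : (T.filter fun p => 0 < ⟪p.1, n⟫).Nonempty := by
    by_contra hempty
    rw [Finset.not_nonempty_iff_eq_empty, Finset.filter_eq_empty_iff] at hempty
    have hray : ∀ s : ℝ, 0 ≤ s → x + s • n ∈ P := fun s hs => by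
      refine interior_subset ?_
      rw [hT.interior_eq]
      intro p hp
      rw [inner_add_right, real_inner_smul_right]
      have := mul_nonpos_of_nonneg_of_nonpos hs (not_lt.1 (hempty hp))
      linarith [hxlt p hp]
    obtain ⟨R, hR⟩ := hP.isCompact.isBounded.exists_norm_le
    have hnpos : 0 < ‖n‖ := norm_pos_iff.2 hn
    have hR0 : 0 ≤ R := (norm_nonneg _).trans (hR _ (interior_subset hx))
    have h1 := hR _ (hray ((2 * R + 1) / ‖n‖) (by positivity))
    have h2 : ‖((2 * R + 1) / ‖n‖) • n‖ = 2 * R + 1 := by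
      rw [norm_smul, Real.norm_of_nonneg (by positivity), div_mul_cancel₀ _ hnpos.ne']
    have h3 := norm_sub_le (x + ((2 * R + 1) / ‖n‖) • n) x
    rw [add_sub_cancel_left, h2] at h3
    linarith [hR _ (interior_subset hx)]
  -- The exit face is the one reached first among those the direction points out of.
  obtain ⟨q, hq, hmin⟩ := Finset.exists_min_image _ (fun p => (p.2 - ⟪p.1, x⟫) / ⟪p.1, n⟫) hne
  rw [Finset.mem_filter] at hq
  set s := (q.2 - ⟪q.1, x⟫) / ⟪q.1, n⟫ with hs
  have hs0 : 0 < s := div_pos (sub_pos.2 (hxlt q hq.1)) hq.2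
  have hexit : ⟪q.1, x + s • n⟫ = q.2 := by
    rw [inner_add_right, real_inner_smul_right, hs, div_mul_cancel₀ _ hq.2.ne']
    ring
  have hin : ∀ τ ∈ Set.Ico 0 s, x + τ • n ∈ interior P := by
    intro τ hτ
    rw [hT.interior_eq]
    intro p hp
    rw [inner_add_right, real_inner_smul_right]
    rcases le_or_gt ⟪p.1, n⟫ 0 with h0 | h0
    · have := mul_nonpos_of_nonneg_of_nonpos hτ.1 h0
      linarith [hxlt p hp]
    · have h1 := hτ.2.trans_le (hmin p (Finset.mem_filter.2 ⟨hp, h0⟩))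
      have := (lt_div_iff₀ h0).1 h1
      linarith
  refine ⟨s, hs0, hin, ⟨?_, ?_⟩, q, hq.1, hq.2, hexit⟩
  · have hc : Continuous fun τ : ℝ => x + τ • n := by fun_prop
    have hmem : s ∈ closure (Set.Ico 0 s) := by
      rw [closure_Ico hs0.ne]; exact ⟨hs0.le, le_rfl⟩
    exact closure_mono interior_subset (map_mem_closure (f := fun τ : ℝ => x + τ • n) hc hmem hin)
  · intro hmem
    rw [hT.interior_eq] at hmem
    exact (hmem q hq.1).ne hexit

end Polytope

end MultiscaleFEM

namespace MultiscaleFEM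

open scoped ENNReal NNReal

/-! ### Slicing along a direction -/

section Slicing

/-- Coordinates adapted to a unit vector `n`: `J` parametrizes the hyperplane orthogonal to `n` by
`ℝ^k` and `Q` is the corresponding projection. -/
theorem exists_coordinates {k : ℕ} {n : E (k + 1)} (hn : ‖n‖ = 1) :
    ∃ (J : (Fin k → ℝ) →L[ℝ] E (k + 1)) (Q : E (k + 1) →L[ℝ] (Fin k → ℝ)),
      (∀ y, Q (J y) = y) ∧ Q n = 0 ∧ (∀ x, ⟪n, x⟫ • n + J (Q x) = x) ∧
      MeasurePreserving (fun p : ℝ × (Fin k → ℝ) => p.1 • n + J p.2)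
        (volume.prod volume) volume := by
  have hv : Orthonormal ℝ (({0} : Set (Fin (k + 1))).domRestrict fun _ => n) := by
    refine ⟨fun i => hn, fun i j hij => absurd (Subsingleton.elim i j) hij⟩
  obtain ⟨b, hb⟩ := hv.exists_orthonormalBasis_extension_of_card_eq (by simp)
  have hb0 : b 0 = n := hb 0 rfl
  let J : (Fin k → ℝ) →L[ℝ] E (k + 1) :=
    LinearMap.toContinuousLinearMap (∑ i, (LinearMap.proj i).smulRight (b i.succ))
  let Q : E (k + 1) →L[ℝ] (Fin k → ℝ) := ContinuousLinearMap.pi fun i => innerSL ℝ (b i.succ)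
  have hJ : ∀ y, J y = ∑ i, y i • b i.succ := fun y => by simp [J]
  have hQ : ∀ x i, Q x i = ⟪b i.succ, x⟫ := fun x i => rfl
  have hbb : ∀ i j, ⟪b i, b j⟫ = if i = j then (1 : ℝ) else 0 := fun i j =>
    orthonormal_iff_ite.1 b.orthonormal i j
  refine ⟨J, Q, fun y => ?_, ?_, fun x => ?_, ?_⟩
  · ext i
    rw [hQ, hJ, inner_sum]
    simp [real_inner_smul_right, hbb]
  · ext i
    rw [hQ, ← hb0, hbb, if_neg (Fin.succ_ne_zero i), Pi.zero_apply]
  · rw [hJ]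
    conv_rhs => rw [← b.sum_repr' x, Fin.sum_univ_succ, hb0]
    rfl
  · have h1 := b.measurePreserving_repr_symm.comp ((PiLp.volume_preserving_toLp (Fin (k + 1))).comp
      (volume_preserving_piFinSuccAbove (fun _ : Fin (k + 1) => ℝ) 0).symm)
    convert h1 using 1
    swap
    · rfl
    funext p
    simp only [Function.comp_apply]
    rw [← b.sum_repr_symm, Fin.sum_univ_succ, hb0, hJ]
    simp [MeasurableEquiv.piFinSuccAbove]

/-- With the sup norm on the parameter space `Fin k → ℝ`, Hausdorff measure is Lebesgue measure with
no normalizing factor. -/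
theorem hausdorffMeasure_pi_fin (k : ℕ) :
    (Measure.hausdorffMeasure k : Measure (Fin k → ℝ)) = volume := by
  rw [← hausdorffMeasure_pi_real, Fintype.card_fin]

/-- The area of a piece of surface is bounded below by that of its projection. -/
theorem setLIntegral_comp_section_le {k : ℕ} {X : Type*} [EMetricSpace X] [MeasurableSpace X]
    [BorelSpace X] {q : (Fin k → ℝ) → X} {Q : X → Fin k → ℝ} {C : ℝ≥0}
    (hq : Measurable q) (hQ : LipschitzWith C Q) (hQq : ∀ y, Q (q y) = y) (S : Set X)
    {g : X → ℝ≥0∞} (hg : Measurable g) :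
    ∫⁻ y in q ⁻¹' S, g (q y) ≤
      (C : ℝ≥0∞) ^ (k : ℝ) * ∫⁻ x in S, g x ∂(Measure.hausdorffMeasure k) := by
  have hle : (volume.restrict (q ⁻¹' S)).map q ≤
      (C : ℝ≥0∞) ^ (k : ℝ) • (Measure.hausdorffMeasure k : Measure X).restrict S := by
    refine Measure.le_iff.2 fun B hB => ?_
    rw [Measure.map_apply hq hB, Measure.restrict_apply (hq hB), Measure.smul_apply, smul_eq_mul,
      Measure.restrict_apply hB, ← Set.preimage_inter, ← hausdorffMeasure_pi_fin]
    -- Since `Q ∘ q` is the identity, the parameters lie in the image under `Q` of the piece of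
    -- surface.
    refine le_trans (measure_mono ?_) (hQ.hausdorffMeasure_image_le (Nat.cast_nonneg k) _)
    exact fun y hy => ⟨q y, hy, hQq y⟩
  rw [← lintegral_map hg hq, ← smul_eq_mul, ← lintegral_smul_measure]
  exact lintegral_mono' hle le_rfl

/-- The area of a parametrized surface is bounded above by that of the domain of parameters. -/
theorem setLIntegral_range_le {k : ℕ} {X : Type*} [EMetricSpace X] [MeasurableSpace X]
    [BorelSpace X] {q : (Fin k → ℝ) → X} {C : ℝ≥0} (hq : LipschitzWith C q)
    {g : X → ℝ≥0∞} (hg : Measurable g) :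
    ∫⁻ x in Set.range q, g x ∂(Measure.hausdorffMeasure k) ≤
      (C : ℝ≥0∞) ^ (k : ℝ) * ∫⁻ y, g (q y) := by
  have hle : (Measure.hausdorffMeasure k : Measure X).restrict (Set.range q) ≤
      (C : ℝ≥0∞) ^ (k : ℝ) • volume.map q := by
    refine Measure.le_iff.2 fun B hB => ?_
    rw [Measure.restrict_apply hB, Measure.smul_apply, smul_eq_mul,
      Measure.map_apply hq.continuous.measurable hB, ← Set.image_preimage_eq_inter_range,
      ← hausdorffMeasure_pi_fin]
    exact hq.hausdorffMeasure_image_le (Nat.cast_nonneg k) _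
  rw [← lintegral_map hg hq.continuous.measurable, ← smul_eq_mul, ← lintegral_smul_measure]
  exact lintegral_mono' hle le_rfl

end Slicing

/-! ### One-dimensional estimates -/

section OneDim

theorem sq_setLIntegral_le {α : Type*} [MeasurableSpace α] {μ : Measure α} {S : Set α}
    {g : α → ℝ≥0∞} (hg : AEMeasurable g (μ.restrict S)) :
    (∫⁻ x in S, g x ∂μ) ^ 2 ≤ μ S * ∫⁻ x in S, g x ^ 2 ∂μ := by
  have h := ENNReal.lintegral_mul_le_Lp_mul_Lq (μ.restrict S) Real.HolderConjugate.two_two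
    (aemeasurable_const (b := (1 : ℝ≥0∞))) hg
  simp only [Pi.mul_apply, one_mul, ENNReal.rpow_two, one_pow, lintegral_const, Measure.restrict_apply_univ]
    at h
  calc (∫⁻ x in S, g x ∂μ) ^ 2
      ≤ ((μ S) ^ (1 / 2 : ℝ) * (∫⁻ x in S, g x ^ 2 ∂μ) ^ (1 / 2 : ℝ)) ^ 2 := by gcongr
    _ = _ := by
      rw [mul_pow, ← ENNReal.rpow_two, ← ENNReal.rpow_two, ← ENNReal.rpow_mul, ← ENNReal.rpow_mul]
      norm_num

theorem ennreal_add_sq_le (a b : ℝ≥0∞) : (a + b) ^ 2 ≤ 2 * a ^ 2 + 2 * b ^ 2 := by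
  have := ENNReal.rpow_add_le_mul_rpow_add_rpow a b (p := 2) one_le_two
  norm_num at this
  rwa [mul_add] at this

theorem enorm_le_add_lintegral_deriv {h : ℝ → ℝ} (hh : ContDiff ℝ 1 h) {s t : ℝ} (hst : s ≤ t) :
    ‖h s‖ₑ ≤ ‖h t‖ₑ + ∫⁻ τ in Set.Ico s t, ‖deriv h τ‖ₑ := by
  have hc : Continuous (deriv h) := hh.continuous_deriv le_rfl
  have hftc : ∫ τ in s..t, deriv h τ = h t - h s :=
    intervalIntegral.integral_deriv_eq_sub
      (fun x _ => (hh.differentiable one_ne_zero).differentiableAt) (hc.intervalIntegrable _ _)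
  have e : h s = h t - ∫ τ in Set.Ioc s t, deriv h τ := by
    rw [← intervalIntegral.integral_of_le hst, hftc]; ring
  rw [setLIntegral_congr Ico_ae_eq_Ioc, e]
  exact enorm_sub_le.trans (by gcongr; exact enorm_integral_le_lintegral_enorm _)

/-- From each point of `S` integrate `h'` up to an exit point where `|h|² ≤ M`, staying in `S`.
Cauchy–Schwarz costs one factor `|S| ≤ δ`, and integrating the pointwise bound over `S` costs
another. -/
theorem setLIntegral_sq_le_of_exit {h : ℝ → ℝ} (hh : ContDiff ℝ 1 h) {S : Set ℝ}
    {δ : ℝ} {M : ℝ≥0∞} (hδ : ∀ s ∈ S, ∀ t ∈ S, |s - t| ≤ δ)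
    (hexit : ∀ s ∈ S, ∃ t, s ≤ t ∧ Set.Ico s t ⊆ S ∧ ‖h t‖ₑ ^ 2 ≤ M) (hS : MeasurableSet S) :
    ∫⁻ t in S, ‖h t‖ₑ ^ 2 ≤
      2 * ENNReal.ofReal δ * M + 2 * ENNReal.ofReal δ ^ 2 * ∫⁻ t in S, ‖deriv h t‖ₑ ^ 2 := by
  have hvol : volume S ≤ ENNReal.ofReal δ := by
    refine (Real.volume_le_diam S).trans (Metric.ediam_le fun s hs t ht => ?_)
    rw [edist_dist, Real.dist_eq]
    exact ENNReal.ofReal_le_ofReal (hδ s hs t ht)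
  have hpt : ∀ s ∈ S, ‖h s‖ₑ ^ 2 ≤
      2 * M + 2 * (ENNReal.ofReal δ * ∫⁻ t in S, ‖deriv h t‖ₑ ^ 2) := by
    intro s hs
    obtain ⟨t, hst, hsub, hM⟩ := hexit s hs
    have hmeas : Measurable fun τ => ‖deriv h τ‖ₑ := (hh.continuous_deriv le_rfl).enorm.measurable
    calc ‖h s‖ₑ ^ 2 ≤ (‖h t‖ₑ + ∫⁻ τ in S, ‖deriv h τ‖ₑ) ^ 2 := by
          gcongr
          exact (enorm_le_add_lintegral_deriv hh hst).trans
            (by gcongr)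
      _ ≤ 2 * ‖h t‖ₑ ^ 2 + 2 * (∫⁻ τ in S, ‖deriv h τ‖ₑ) ^ 2 := ennreal_add_sq_le _ _
      _ ≤ _ := by
          gcongr
          exact (sq_setLIntegral_le hmeas.aemeasurable).trans (by gcongr)
  calc ∫⁻ t in S, ‖h t‖ₑ ^ 2
      ≤ ∫⁻ _ in S, (2 * M + 2 * (ENNReal.ofReal δ * ∫⁻ t in S, ‖deriv h t‖ₑ ^ 2)) :=
        setLIntegral_mono' hS hpt
    _ ≤ (2 * M + 2 * (ENNReal.ofReal δ * ∫⁻ t in S, ‖deriv h t‖ₑ ^ 2)) * ENNReal.ofReal δ := by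
        rw [lintegral_const, Measure.restrict_apply_univ]
        gcongr
    _ = _ := by ring

/-- The one-dimensional trace inequality on the line. -/
theorem sq_enorm_le_lintegral {h : ℝ → ℝ} (hh : ContDiff ℝ 1 h) (hc : HasCompactSupport h)
    (t : ℝ) : ‖h t‖ₑ ^ 2 ≤ ∫⁻ s, (‖h s‖ₑ ^ 2 + ‖deriv h s‖ₑ ^ 2) := by
  -- The fundamental theorem is applied to `h²`, with `|(h²)'| = 2|h h'| ≤ h² + h'²`.
  have hc2 : HasCompactSupport fun s => h s ^ 2 := hc.comp_left (g := fun r => r ^ 2) (by norm_num)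
  have h1 := hc2.enorm_le_lintegral_Ici_deriv (hh.pow 2) t
  rw [enorm_pow] at h1
  refine h1.trans ((setLIntegral_le_lintegral _ _).trans (lintegral_mono fun s => ?_))
  have hd : deriv (fun s => h s ^ 2) s = 2 * h s * deriv h s := by
    have := ((hh.differentiable one_ne_zero) s).hasDerivAt.pow 2
    refine this.deriv.trans ?_
    norm_num
  rw [hd, Real.enorm_eq_ofReal_abs, Real.enorm_eq_ofReal_abs, Real.enorm_eq_ofReal_abs,
    ← ENNReal.ofReal_pow (abs_nonneg _), ← ENNReal.ofReal_pow (abs_nonneg _),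
    ← ENNReal.ofReal_add (by positivity) (by positivity)]
  refine ENNReal.ofReal_le_ofReal ?_
  rw [abs_mul, abs_mul, abs_two]
  nlinarith [sq_nonneg (|h s| - |deriv h s|)]

end OneDim

/-! ### Estimates on slices of polytopes -/

section Estimates

variable {k : ℕ}

theorem hasDerivAt_comp_line {d : ℕ} {η : E d → ℝ} (hη : ContDiff ℝ 1 η) (n z : E d) (t : ℝ) :
    HasDerivAt (fun t : ℝ => η (t • n + z)) ⟪∇ η (t • n + z), n⟫ t := by
  have h1 : HasDerivAt (fun t : ℝ => t • n + z) n t := by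
    simpa using ((hasDerivAt_id t).smul_const n).add_const z
  have h2 := ((hη.differentiable one_ne_zero) (t • n + z)).hasFDerivAt.comp_hasDerivAt t h1
  rw [inner_gradient_left]
  exact h2

theorem contDiff_comp_line {d : ℕ} {η : E d → ℝ} (hη : ContDiff ℝ 1 η) (n z : E d) :
    ContDiff ℝ 1 fun t : ℝ => η (t • n + z) := by
  fun_prop

theorem enorm_deriv_comp_line_le {d : ℕ} {η : E d → ℝ} (hη : ContDiff ℝ 1 η) {n : E d}
    (hn : ‖n‖ = 1) (z : E d) (t : ℝ) :
    ‖deriv (fun t : ℝ => η (t • n + z)) t‖ₑ ≤ ‖∇ η (t • n + z)‖ₑ := by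
  rw [(hasDerivAt_comp_line hη n z t).deriv, enorm_le_iff_norm_le]
  simpa [hn] using norm_inner_le_norm (𝕜 := ℝ) (∇ η (t • n + z)) n

/-- Let `K` be a part of the interior of a polytope `P` that is closed under moving in the
direction `n` and of width at most `δ` in that direction. Then the `L²(K)` norm is controlled by
the trace on `∂P` and the gradient on `K`. -/
theorem exists_setLIntegral_sq_le {P : Set (E (k + 1))} (hP : IsConvexPolytope P)
    {T : Finset (E (k + 1) × ℝ)} (hT : IsHalfspaceDescription P T) {n : E (k + 1)}
    (hn : ‖n‖ = 1) :
    ∃ A : ℝ≥0∞, A ≠ ⊤ ∧ ∀ (K : Set (E (k + 1))) (δ : ℝ), K ⊆ interior P → MeasurableSet K →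
      (∀ x ∈ K, ∀ s : ℝ, 0 ≤ s → x + s • n ∈ interior P → x + s • n ∈ K) →
      (∀ x ∈ K, ∀ s : ℝ, x + s • n ∈ K → |s| ≤ δ) →
      ∀ η : E (k + 1) → ℝ, ContDiff ℝ 1 η →
        ∫⁻ x in K, ‖η x‖ₑ ^ 2 ≤
          ENNReal.ofReal δ * (A * ∫⁻ x in frontier P, ‖η x‖ₑ ^ 2 ∂(Measure.hausdorffMeasure k)) +
            2 * ENNReal.ofReal δ ^ 2 * ∫⁻ x in K, ‖∇ η x‖ₑ ^ 2 := by
  obtain ⟨J, Q, hQJ, hQn, hJQ, hmp⟩ := exists_coordinates hn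
  have hn0 : n ≠ 0 := by rw [← norm_ne_zero_iff, hn]; exact one_ne_zero
  -- The `2` comes from `(a + b)² ≤ 2a² + 2b²`, `T.card` counts the possible exit faces, and `‖Q‖ ^
  -- k` compares boundary area with its projection along `n`.
  refine ⟨2 * (T.card * (‖Q‖₊ : ℝ≥0∞) ^ (k : ℝ)), ?_, ?_⟩
  · exact ENNReal.mul_ne_top ENNReal.ofNat_ne_top (ENNReal.mul_ne_top (ENNReal.natCast_ne_top _)
      (ENNReal.rpow_ne_top_of_nonneg (Nat.cast_nonneg k) ENNReal.coe_ne_top))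
  intro K δ hK hKm hup hwidth η hη
  -- The point where the line over `y` in direction `n` meets the hyperplane of `p`. If they are
  -- parallel, division by zero gives `J y`, which is harmless: `q p` is still a section of `Q`.
  let q : E (k + 1) × ℝ → (Fin k → ℝ) → E (k + 1) := fun p y =>
    ((p.2 - ⟪p.1, J y⟫) / ⟪p.1, n⟫) • n + J y
  have hqm : ∀ p, Measurable (q p) := fun p => by
    have : Continuous (q p) := by unfold q; fun_prop
    exact this.measurable
  have hQq : ∀ p y, Q (q p y) = y := fun p y => by simp [q, hQn, hQJ]
  have hηm : Measurable fun x => ‖η x‖ₑ ^ 2 := (hη.continuous.enorm.measurable).pow_const 2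
  have hgm : Measurable fun x => ‖∇ η x‖ₑ ^ 2 :=
    ((continuous_gradient hη).enorm.measurable).pow_const 2
  have hslice : ∀ g : E (k + 1) → ℝ≥0∞, Measurable g →
      ∫⁻ x in K, g x = ∫⁻ y, ∫⁻ t in {t : ℝ | t • n + J y ∈ K}, g (t • n + J y) := by
    intro g hg
    have hgK : Measurable (K.indicator g) := hg.indicator hKm
    rw [← lintegral_indicator hKm, ← hmp.lintegral_comp hgK]
    refine (lintegral_prod_symm _ (hgK.comp hmp.measurable).aemeasurable).trans ?_
    refine lintegral_congr fun y => ?_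
    have hmeas : MeasurableSet {t : ℝ | t • n + J y ∈ K} :=
      (show Measurable fun t : ℝ => t • n + J y by fun_prop) hKm
    rw [← lintegral_indicator hmeas]
    rfl
  -- Summing over all hyperplanes dominates the value at the exit point without a measurable choice
  -- of exit face.
  let M : (Fin k → ℝ) → ℝ≥0∞ := fun y =>
    ∑ p ∈ T, (q p ⁻¹' frontier P).indicator (fun y => ‖η (q p y)‖ₑ ^ 2) y
  have hfm : ∀ p, MeasurableSet (q p ⁻¹' frontier P) := fun p =>
    hqm p isClosed_frontier.measurableSet
  have hMm : ∀ p ∈ T, Measurable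
      ((q p ⁻¹' frontier P).indicator (fun y => ‖η (q p y)‖ₑ ^ 2)) := fun p _ =>
    (hηm.comp (hqm p)).indicator (hfm p)
  have hM : ∫⁻ y, M y ≤ T.card * (‖Q‖₊ : ℝ≥0∞) ^ (k : ℝ) *
      ∫⁻ x in frontier P, ‖η x‖ₑ ^ 2 ∂(Measure.hausdorffMeasure k) := by
    rw [lintegral_finsetSum T hMm]
    calc _ ≤ ∑ p ∈ T, (‖Q‖₊ : ℝ≥0∞) ^ (k : ℝ) *
          ∫⁻ x in frontier P, ‖η x‖ₑ ^ 2 ∂(Measure.hausdorffMeasure k) := by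
          refine Finset.sum_le_sum fun p _ => ?_
          rw [lintegral_indicator (hfm p)]
          exact setLIntegral_comp_section_le (hqm p) Q.lipschitz (hQq p) _ hηm
      _ = _ := by rw [Finset.sum_const, nsmul_eq_mul, mul_assoc]
  have hline : ∀ y, ∫⁻ t in {t : ℝ | t • n + J y ∈ K}, ‖η (t • n + J y)‖ₑ ^ 2 ≤
      2 * ENNReal.ofReal δ * M y + 2 * ENNReal.ofReal δ ^ 2 *
        ∫⁻ t in {t : ℝ | t • n + J y ∈ K}, ‖∇ η (t • n + J y)‖ₑ ^ 2 := by
    intro y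
    have hmeas : MeasurableSet {t : ℝ | t • n + J y ∈ K} :=
      (show Measurable fun t : ℝ => t • n + J y by fun_prop) hKm
    have hshift : ∀ s t : ℝ, t • n + J y + s • n = (t + s) • n + J y := fun s t => by
      rw [add_smul]; abel
    refine (setLIntegral_sq_le_of_exit (contDiff_comp_line hη n (J y)) (δ := δ) (M := M y)
      ?_ ?_ hmeas).trans ?_
    · intro s hs t ht
      refine hwidth _ ht (s - t) ?_
      rw [hshift, add_sub_cancel]
      exact hs
    · intro s hs
      obtain ⟨r, hr, hin, hfr, p, hp, hpn, hpe⟩ := hT.exists_exit hP hn0 (hK hs)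
      refine ⟨s + r, by linarith, fun τ hτ => ?_, ?_⟩
      · have h1 := hup _ hs (τ - s) (by linarith [hτ.1])
          (hin _ ⟨by linarith [hτ.1], by linarith [hτ.2]⟩)
        rw [hshift, add_sub_cancel] at h1
        exact h1
      · rw [hshift] at hfr hpe
        have hqe : q p y = (s + r) • n + J y := by
          have : (p.2 - ⟪p.1, J y⟫) / ⟪p.1, n⟫ = s + r := by
            rw [div_eq_iff hpn.ne', ← hpe, inner_add_right, real_inner_smul_right]
            ring
          simp only [q, this]
        have hle := Finset.single_le_sum (f := fun p =>
          (q p ⁻¹' frontier P).indicator (fun y => ‖η (q p y)‖ₑ ^ 2) y)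
          (fun _ _ => zero_le) hp
        refine le_trans (le_of_eq ?_) hle
        rw [Set.indicator_of_mem (by rw [Set.mem_preimage, hqe]; exact hfr), hqe]
    · gcongr with t
      exact enorm_deriv_comp_line_le hη hn (J y) t
  have hMm' : Measurable M := Finset.measurable_sum T hMm
  rw [hslice _ hηm, hslice _ hgm]
  calc _ ≤ ∫⁻ y, (2 * ENNReal.ofReal δ * M y + 2 * ENNReal.ofReal δ ^ 2 *
        ∫⁻ t in {t : ℝ | t • n + J y ∈ K}, ‖∇ η (t • n + J y)‖ₑ ^ 2) := lintegral_mono hline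
    _ = 2 * ENNReal.ofReal δ * (∫⁻ y, M y) + 2 * ENNReal.ofReal δ ^ 2 *
        ∫⁻ y, ∫⁻ t in {t : ℝ | t • n + J y ∈ K}, ‖∇ η (t • n + J y)‖ₑ ^ 2 := by
      rw [lintegral_add_left (hMm'.const_mul _), lintegral_const_mul _ hMm',
        lintegral_const_mul' _ _ (ENNReal.mul_ne_top ENNReal.ofNat_ne_top (by finiteness))]
    _ ≤ _ := by
      refine add_le_add_left ?_ _
      exact (mul_le_mul_right hM _).trans_eq (by ring)

/-- The trace inequality on a hyperplane. -/
theorem exists_setLIntegral_hyperplane_le {n : E (k + 1)} (hn : ‖n‖ = 1) (b : ℝ) :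
    ∃ A : ℝ≥0∞, A ≠ ⊤ ∧ ∀ η : E (k + 1) → ℝ, ContDiff ℝ 1 η → HasCompactSupport η →
      ∫⁻ x in {x | ⟪n, x⟫ = b}, ‖η x‖ₑ ^ 2 ∂(Measure.hausdorffMeasure k) ≤
        A * ∫⁻ x, (‖η x‖ₑ ^ 2 + ‖∇ η x‖ₑ ^ 2) := by
  obtain ⟨J, Q, hQJ, hQn, hJQ, hmp⟩ := exists_coordinates hn
  refine ⟨(‖J‖₊ : ℝ≥0∞) ^ (k : ℝ),
    ENNReal.rpow_ne_top_of_nonneg (Nat.cast_nonneg k) ENNReal.coe_ne_top, fun η hη hc => ?_⟩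
  have hq : LipschitzWith ‖J‖₊ fun y => b • n + J y := fun y z => by
    rw [edist_add_left]
    exact J.lipschitz y z
  have hηm : Measurable fun x => ‖η x‖ₑ ^ 2 := (hη.continuous.enorm.measurable).pow_const 2
  have hgm : Measurable fun x => ‖∇ η x‖ₑ ^ 2 :=
    ((continuous_gradient hη).enorm.measurable).pow_const 2
  have hsub : {x | ⟪n, x⟫ = b} ⊆ Set.range fun y => b • n + J y := fun x hx =>
    ⟨Q x, (congrArg (fun c : ℝ => c • n + J (Q x)) (show ⟪n, x⟫ = b from hx).symm).trans (hJQ x)⟩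
  calc _ ≤ ∫⁻ x in Set.range fun y => b • n + J y, ‖η x‖ₑ ^ 2 ∂(Measure.hausdorffMeasure k) :=
        lintegral_mono_set hsub
    _ ≤ (‖J‖₊ : ℝ≥0∞) ^ (k : ℝ) * ∫⁻ y, ‖η (b • n + J y)‖ₑ ^ 2 := setLIntegral_range_le hq hηm
    _ ≤ (‖J‖₊ : ℝ≥0∞) ^ (k : ℝ) * ∫⁻ y, ∫⁻ t : ℝ,
          (‖η (t • n + J y)‖ₑ ^ 2 + ‖∇ η (t • n + J y)‖ₑ ^ 2) := by
        gcongr with y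
        have hcl : HasCompactSupport fun t : ℝ => η (t • n + J y) := by
          refine hc.comp_isClosedEmbedding (g := fun t : ℝ => t • n + J y) ?_
          refine Isometry.isClosedEmbedding (Isometry.of_dist_eq fun s t => ?_)
          rw [dist_add_right, dist_eq_norm, ← sub_smul, norm_smul, hn, mul_one, Real.dist_eq,
            Real.norm_eq_abs]
        refine (sq_enorm_le_lintegral (contDiff_comp_line hη n (J y)) hcl b).trans ?_
        gcongr with t
        exact enorm_deriv_comp_line_le hη hn (J y) t
    _ = _ := by
        congr 1
        refine Eq.trans ?_ (hmp.lintegral_comp (hηm.add hgm))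
        exact (lintegral_prod_symm _ ((hηm.add hgm).comp hmp.measurable).aemeasurable).symm

/-- The trace inequality on the boundary of a polytope. -/
theorem exists_setLIntegral_frontier_le {P : Set (E (k + 1))} (hP : IsConvexPolytope P) :
    ∃ A : ℝ≥0∞, A ≠ ⊤ ∧ ∀ η : E (k + 1) → ℝ, ContDiff ℝ 1 η → HasCompactSupport η →
      ∫⁻ x in frontier P, ‖η x‖ₑ ^ 2 ∂(Measure.hausdorffMeasure k) ≤
        A * ∫⁻ x, (‖η x‖ₑ ^ 2 + ‖∇ η x‖ₑ ^ 2) := by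
  obtain ⟨T, hT⟩ := hP.exists_halfspaceDescription
  choose! A hA hA' using fun p (hp : p ∈ T) =>
    exists_setLIntegral_hyperplane_le (hT.norm_eq p hp) p.2
  refine ⟨∑ p ∈ T, A p, ENNReal.sum_ne_top.2 hA, fun η hη hc => ?_⟩
  have hsub : frontier P ⊆ ⋃ p : T, {x | ⟪p.1.1, x⟫ = p.1.2} := fun x hx => by
    obtain ⟨p, hp, hpx⟩ := hT.exists_inner_eq hP hx
    exact Set.mem_iUnion.2 ⟨⟨p, hp⟩, hpx⟩
  calc _ ≤ ∫⁻ x in ⋃ p : T, {x | ⟪p.1.1, x⟫ = p.1.2}, ‖η x‖ₑ ^ 2 ∂(Measure.hausdorffMeasure k) :=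
        lintegral_mono_set hsub
    _ ≤ ∑ p ∈ T, ∫⁻ x in {x | ⟪p.1, x⟫ = p.2}, ‖η x‖ₑ ^ 2 ∂(Measure.hausdorffMeasure k) := by
        refine (lintegral_iUnion_le _ _).trans_eq ?_
        rw [tsum_fintype]
        exact Finset.sum_coe_sort T fun p =>
          ∫⁻ x in {x | ⟪p.1, x⟫ = p.2}, ‖η x‖ₑ ^ 2 ∂(Measure.hausdorffMeasure k)
    _ ≤ ∑ p ∈ T, A p * ∫⁻ x, (‖η x‖ₑ ^ 2 + ‖∇ η x‖ₑ ^ 2) :=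
        Finset.sum_le_sum fun p hp => hA' p hp η hη hc
    _ = _ := by rw [Finset.sum_mul]

end Estimates

end MultiscaleFEM

namespace MultiscaleFEM

open scoped ENNReal

/-! ### Functions with vanishing trace on the boundary of a polytope -/

section Cutoff

theorem deriv_smoothTransition_of_one_lt {t : ℝ} (h1 : 1 < t) :
    deriv Real.smoothTransition t = 0 := by
  have : Real.smoothTransition =ᶠ[𝓝 t] fun _ => 1 := by
    filter_upwards [Ioi_mem_nhds h1] with s hs
    exact Real.smoothTransition.one_of_one_le (le_of_lt hs)
  rw [this.deriv_eq, deriv_const]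

theorem exists_abs_deriv_smoothTransition_le :
    ∃ M : ℝ, 0 ≤ M ∧ ∀ t, |deriv Real.smoothTransition t| ≤ M := by
  have hc : Continuous (deriv Real.smoothTransition) :=
    (Real.smoothTransition.contDiff (n := 1)).continuous_deriv le_rfl
  obtain ⟨M, hM⟩ := (isCompact_Icc (a := (0 : ℝ)) (b := 1)).exists_bound_of_continuousOn
    hc.continuousOn
  refine ⟨max M 0, le_max_right _ _, fun t => ?_⟩
  by_cases ht : t ∈ Set.Icc (0 : ℝ) 1
  · exact (hM t ht).trans (le_max_left _ _)
  · have h0 : deriv Real.smoothTransition t = 0 := by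
      rcases lt_or_ge t 0 with h | h
      · have : Real.smoothTransition =ᶠ[𝓝 t] fun _ => 0 := by
          filter_upwards [Iio_mem_nhds h] with s hs
          exact Real.smoothTransition.zero_of_nonpos (le_of_lt hs)
        rw [this.deriv_eq, deriv_const]
      · have h1 : 1 < t := by
          by_contra h'
          exact ht ⟨h, not_lt.1 h'⟩
        exact deriv_smoothTransition_of_one_lt h1
    rw [h0, abs_zero]
    exact le_max_right _ _

/-- Smooth cutoff functions of a polytope, equal to `1` away from an `ε`-neighbourhood of the
boundary. -/
theorem IsHalfspaceDescription.exists_cutoff {d : ℕ} {P : Set (E d)} {T : Finset (E d × ℝ)}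
    (hT : IsHalfspaceDescription P T) (hP : IsConvexPolytope P) :
    ∃ M : ℝ, 0 ≤ M ∧ ∀ ε : ℝ, 0 < ε → ∃ χ : E d → ℝ, IsTestFun (interior P) χ ∧
      (∀ x, χ x ∈ Set.Icc 0 1) ∧ (∀ x, (∀ p ∈ T, 2 * ε ≤ p.2 - ⟪p.1, x⟫) → χ x = 1) ∧
      ∀ x, ‖∇ χ x‖ ≤ ∑ p ∈ T, {x | p.2 - 2 * ε ≤ ⟪p.1, x⟫}.indicator (fun _ => M / ε) x := by
  classical
  obtain ⟨M, hM0, hM⟩ := exists_abs_deriv_smoothTransition_le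
  refine ⟨M, hM0, fun ε hε => ?_⟩
  -- Signed distance to the hyperplane of `p` in units of `ε`, shifted so that the smooth step is
  -- `0` within distance `ε` of it and `1` beyond `2ε`.
  let l : E d × ℝ → E d → ℝ := fun p x => (p.2 - ⟪p.1, x⟫) / ε - 1
  let g : E d × ℝ → E d → ℝ := fun p x => Real.smoothTransition (l p x)
  have hg01 : ∀ p x, g p x ∈ Set.Icc (0 : ℝ) 1 := fun p x =>
    ⟨Real.smoothTransition.nonneg _, Real.smoothTransition.le_one _⟩
  have hl : ∀ p x, HasFDerivAt (l p) ((-ε⁻¹) • innerSL ℝ p.1) x := by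
    intro p x
    have h1 : HasFDerivAt (fun x => ⟪p.1, x⟫) (innerSL ℝ p.1) x := (innerSL ℝ p.1).hasFDerivAt
    have h2 := ((h1.const_sub p.2).mul_const ε⁻¹).sub_const 1
    simpa only [l, div_eq_mul_inv, smul_neg, neg_smul] using h2
  have hg : ∀ p x, HasFDerivAt (g p)
      (deriv Real.smoothTransition (l p x) • ((-ε⁻¹) • innerSL ℝ p.1)) x := by
    intro p x
    have hd : HasDerivAt Real.smoothTransition (deriv Real.smoothTransition (l p x)) (l p x) :=
      ((Real.smoothTransition.contDiff (n := 1)).differentiable one_ne_zero _).hasDerivAt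
    exact hd.comp_hasFDerivAt x (hl p x)
  have hgs : ∀ p, ContDiff ℝ ∞ (g p) := fun p => by
    refine Real.smoothTransition.contDiff.comp ?_
    have h1 : ContDiff ℝ ∞ fun x => ⟪p.1, x⟫ := (innerSL ℝ p.1).contDiff
    exact ((contDiff_const.sub h1).div_const ε).sub contDiff_const
  have hsub : tsupport (fun x => ∏ p ∈ T, g p x) ⊆ {x | ∀ p ∈ T, ⟪p.1, x⟫ ≤ p.2 - ε} := by
    refine closure_minimal (fun x hx p hp => ?_) ?_
    · by_contra hlt
      refine hx (Finset.prod_eq_zero hp (Real.smoothTransition.zero_of_nonpos ?_))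
      have : (p.2 - ⟪p.1, x⟫) / ε ≤ 1 := (div_le_one hε).2 (by linarith)
      linarith
    · simp only [Set.ofPred_forall]
      exact isClosed_biInter fun p _ => isClosed_le (by fun_prop) continuous_const
  have hint : tsupport (fun x => ∏ p ∈ T, g p x) ⊆ interior P := fun x hx => by
    rw [hT.interior_eq]
    intro p hp
    linarith [hsub hx p hp]
  refine ⟨fun x => ∏ p ∈ T, g p x, ⟨contDiff_prod fun p _ => hgs p, ?_, hint⟩, fun x => ⟨?_, ?_⟩,
    fun x hx => ?_, fun x => ?_⟩
  · exact hP.isCompact.of_isClosed_subset (isClosed_tsupport _) (hint.trans interior_subset)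
  · exact Finset.prod_nonneg fun p _ => (hg01 p x).1
  · exact Finset.prod_le_one (fun p _ => (hg01 p x).1) fun p _ => (hg01 p x).2
  · refine Finset.prod_eq_one fun p hp => Real.smoothTransition.one_of_one_le ?_
    have : 2 ≤ (p.2 - ⟪p.1, x⟫) / ε := (le_div_iff₀ hε).2 (hx p hp)
    linarith
  -- In the product rule the undifferentiated factors are at most `1`; the differentiated one has
  -- slope at most `M / ε` and vanishes farther than `2ε` inside the face.
  · have hd := HasFDerivAt.finsetProd (u := T) fun p _ => hg p x
    rw [gradient, LinearIsometryEquiv.norm_map, hd.fderiv]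
    refine (norm_sum_le _ _).trans (Finset.sum_le_sum fun p hp => ?_)
    have hprod : ‖∏ q ∈ T.erase p, g q x‖ ≤ 1 := by
      rw [Real.norm_of_nonneg (Finset.prod_nonneg fun q _ => (hg01 q x).1)]
      exact Finset.prod_le_one (fun q _ => (hg01 q x).1) fun q _ => (hg01 q x).2
    rw [norm_smul]
    refine (mul_le_of_le_one_left (norm_nonneg _) hprod).trans ?_
    rw [norm_smul, norm_smul, innerSL_apply_norm, hT.norm_eq p hp, mul_one, norm_neg, norm_inv,
      Real.norm_eq_abs, Real.norm_of_nonneg hε.le]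
    by_cases hx : p.2 - 2 * ε ≤ ⟪p.1, x⟫
    · rw [Set.indicator_of_mem (by exact hx), div_eq_mul_inv]
      gcongr
      exact hM _
    · rw [Set.indicator_of_notMem (by exact hx), deriv_smoothTransition_of_one_lt, abs_zero,
        zero_mul]
      have : 2 < (p.2 - ⟪p.1, x⟫) / ε := (lt_div_iff₀ hε).2 (by linarith)
      change 1 < (p.2 - ⟪p.1, x⟫) / ε - 1
      linarith

end Cutoff

/-! ### Poincaré, Hardy and Green's formula for functions with zero trace on a polytope. -/

section ZeroTrace

variable {k : ℕ} {Ω P K : Set (E (k + 1))} {η : ℕ → E (k + 1) → ℝ} {z : E (k + 1) → ℝ}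

/-- `η` is an approximation in `H¹(Ω)` of `z` by test functions whose traces on the boundary of
`P` tend to zero. -/
structure ZeroTraceApprox (Ω P : Set (E (k + 1))) (η : ℕ → E (k + 1) → ℝ)
    (z : E (k + 1) → ℝ) : Prop where
  memH1 : MemH1 Ω z
  isTestFun : ∀ j, IsTestFun Ω (η j)
  tendsto : TendstoH1 Ω η z
  trace : Tendsto (fun j => ∫⁻ x in frontier P, ‖η j x‖ₑ ^ 2 ∂(Measure.hausdorffMeasure k)) atTop
    (𝓝 0)

theorem ZeroTraceApprox.tendsto_value (h : ZeroTraceApprox Ω P η z) (hK : K ⊆ Ω) :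
    Tendsto (fun j => eLpNorm (η j - z) 2 (volume.restrict K)) atTop (𝓝 0) :=
  tendsto_of_tendsto_of_tendsto_of_le_of_le tendsto_const_nhds h.tendsto.value
    (fun _ => zero_le) fun _ => eLpNorm_mono_measure _ (Measure.restrict_mono hK le_rfl)

theorem ZeroTraceApprox.tendsto_grad (h : ZeroTraceApprox Ω P η z) (hK : K ⊆ Ω) :
    Tendsto (fun j => eLpNorm (∇ (η j) - weakGrad Ω z) 2 (volume.restrict K)) atTop (𝓝 0) :=
  tendsto_of_tendsto_of_tendsto_of_le_of_le tendsto_const_nhds h.tendsto.grad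
    (fun _ => zero_le) fun _ => eLpNorm_mono_measure _ (Measure.restrict_mono hK le_rfl)

theorem ZeroTraceApprox.memLp (h : ZeroTraceApprox Ω P η z) (hK : K ⊆ Ω) :
    MemLp z 2 (volume.restrict K) :=
  h.memH1.memLp.mono_measure (Measure.restrict_mono hK le_rfl)

theorem ZeroTraceApprox.memLp_weakGrad (h : ZeroTraceApprox Ω P η z) (hK : K ⊆ Ω) :
    MemLp (weakGrad Ω z) 2 (volume.restrict K) :=
  h.memH1.memLp_weakGrad.mono_measure (Measure.restrict_mono hK le_rfl)

/-- Pass to the limit in the slicing estimate for `η j`. The boundary term tends to zero together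
with its shape-dependent constant, which is why the final error constant does not see the shapes of
the cells. -/
theorem ZeroTraceApprox.toReal_eLpNorm_le (h : ZeroTraceApprox Ω P η z)
    (hP : IsConvexPolytope P) (hPΩ : interior P ⊆ Ω) {n : E (k + 1)} (hn : ‖n‖ = 1) {δ : ℝ}
    (hδ : 0 ≤ δ) (hK : K ⊆ interior P) (hKm : MeasurableSet K)
    (hup : ∀ x ∈ K, ∀ s : ℝ, 0 ≤ s → x + s • n ∈ interior P → x + s • n ∈ K)
    (hwidth : ∀ x ∈ K, ∀ s : ℝ, x + s • n ∈ K → |s| ≤ δ) :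
    (eLpNorm z 2 (volume.restrict K)).toReal ≤
      2 * δ * (eLpNorm (weakGrad Ω z) 2 (volume.restrict K)).toReal := by
  obtain ⟨T, hT⟩ := hP.exists_halfspaceDescription
  obtain ⟨A, hA, hineq⟩ := exists_setLIntegral_sq_le hP hT hn
  have hKΩ : K ⊆ Ω := hK.trans hPΩ
  have hv := tendsto_eLpNorm_of_tendsto (fun j => ((h.isTestFun j).memLp K).1) (h.memLp hKΩ)
    (h.tendsto_value hKΩ)
  have hg := tendsto_eLpNorm_of_tendsto (fun j => ((h.isTestFun j).memLp_gradient K).1)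
    (h.memLp_weakGrad hKΩ) (h.tendsto_grad hKΩ)
  have hrhs : Tendsto (fun j => ENNReal.ofReal δ *
      (A * ∫⁻ x in frontier P, ‖η j x‖ₑ ^ 2 ∂(Measure.hausdorffMeasure k)) +
      2 * ENNReal.ofReal δ ^ 2 * eLpNorm (∇ (η j)) 2 (volume.restrict K) ^ 2) atTop
      (𝓝 (ENNReal.ofReal δ * (A * 0) + 2 * ENNReal.ofReal δ ^ 2 *
        eLpNorm (weakGrad Ω z) 2 (volume.restrict K) ^ 2)) := by
    refine Tendsto.add ?_ ?_
    · exact ENNReal.Tendsto.const_mul (ENNReal.Tendsto.const_mul h.trace (Or.inr hA))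
        (Or.inr ENNReal.ofReal_ne_top)
    · exact ENNReal.Tendsto.const_mul (ENNReal.Tendsto.pow hg)
        (Or.inr (ENNReal.mul_ne_top ENNReal.ofNat_ne_top (by finiteness)))
  have hle := le_of_tendsto_of_tendsto' (ENNReal.Tendsto.pow hv) hrhs fun j => by
    rw [eLpNorm_two_sq, eLpNorm_two_sq]
    exact hineq K δ hK hKm hup hwidth (η j) (h.isTestFun j).contDiff_one
  rw [mul_zero, mul_zero, zero_add] at hle
  have hfin : 2 * ENNReal.ofReal δ ^ 2 * eLpNorm (weakGrad Ω z) 2 (volume.restrict K) ^ 2 ≠ ⊤ :=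
    ENNReal.mul_ne_top (ENNReal.mul_ne_top ENNReal.ofNat_ne_top (by finiteness))
      (ENNReal.pow_ne_top (h.memLp_weakGrad hKΩ).2.ne)
  have hle' := ENNReal.toReal_mono hfin hle
  rw [ENNReal.toReal_mul, ENNReal.toReal_mul, ENNReal.toReal_pow, ENNReal.toReal_pow,
    ENNReal.toReal_pow, ENNReal.toReal_ofReal hδ, ENNReal.toReal_ofNat] at hle'
  -- The limit gives the factor `2δ²` for the squares; it is relaxed to `4δ²` to avoid a square root
  -- of two.
  refine abs_le_of_sq_le_sq' ?_ (by positivity) |>.2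
  refine hle'.trans ?_
  have : 0 ≤ δ ^ 2 * (eLpNorm (weakGrad Ω z) 2 (volume.restrict K)).toReal ^ 2 := by positivity
  nlinarith

/-- The Poincaré inequality for functions with vanishing trace. -/
theorem ZeroTraceApprox.poincare (h : ZeroTraceApprox Ω P η z)
    (hP : IsConvexPolytope P) (hPΩ : interior P ⊆ Ω) {δ : ℝ} (hδ : Metric.diam P ≤ δ) :
    (eLpNorm z 2 (volume.restrict (interior P))).toReal ≤
      2 * δ * (eLpNorm (weakGrad Ω z) 2 (volume.restrict (interior P))).toReal := by
  have hn : ‖(EuclideanSpace.single 0 1 : E (k + 1))‖ = 1 := by simp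
  refine h.toReal_eLpNorm_le hP hPΩ hn (Metric.diam_nonneg.trans hδ) subset_rfl
    isOpen_interior.measurableSet (fun x _ s _ hs => hs) fun x hx s hs => ?_
  have := Metric.dist_le_diam_of_mem hP.isCompact.isBounded (interior_subset hs)
    (interior_subset hx)
  rw [dist_eq_norm, add_sub_cancel_left, norm_smul, hn, mul_one, Real.norm_eq_abs] at this
  exact this.trans hδ

/-- The Hardy-type inequality in a layer along a face. -/
theorem ZeroTraceApprox.layer (h : ZeroTraceApprox Ω P η z)
    (hP : IsConvexPolytope P) (hPΩ : interior P ⊆ Ω) {T : Finset (E (k + 1) × ℝ)}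
    (hT : IsHalfspaceDescription P T) {p : E (k + 1) × ℝ} (hp : p ∈ T) {δ : ℝ} (hδ : 0 ≤ δ) :
    (eLpNorm z 2 (volume.restrict (interior P ∩ {x | p.2 - δ ≤ ⟪p.1, x⟫}))).toReal ≤
      2 * δ * (eLpNorm (weakGrad Ω z) 2 (volume.restrict (interior P))).toReal := by
  have hn := hT.norm_eq p hp
  have hsub : interior P ∩ {x | p.2 - δ ≤ ⟪p.1, x⟫} ⊆ interior P := Set.inter_subset_left
  have hinner : ∀ (x : E (k + 1)) (s : ℝ), ⟪p.1, x + s • p.1⟫ = ⟪p.1, x⟫ + s := fun x s => by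
    rw [inner_add_right, real_inner_smul_right, real_inner_self_eq_norm_sq, hn]
    ring
  have hlt : ∀ x ∈ interior P, ⟪p.1, x⟫ < p.2 := fun x hx => by
    rw [hT.interior_eq] at hx
    exact hx p hp
  -- Moving along the outer normal keeps a point in the layer until it leaves `P`, and the layer has
  -- width at most `δ` in that direction.
  refine (h.toReal_eLpNorm_le hP hPΩ hn hδ hsub ?_ ?_ ?_).trans ?_
  · exact isOpen_interior.measurableSet.inter
      (isClosed_le continuous_const (by fun_prop)).measurableSet
  · intro x hx s hs hxs
    refine ⟨hxs, ?_⟩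
    have h1 : p.2 - δ ≤ ⟪p.1, x⟫ := hx.2
    change p.2 - δ ≤ ⟪p.1, x + s • p.1⟫
    rw [hinner]
    linarith
  · intro x hx s hxs
    have h1 : p.2 - δ ≤ ⟪p.1, x⟫ := hx.2
    have h2 : p.2 - δ ≤ ⟪p.1, x + s • p.1⟫ := hxs.2
    have h3 := hlt _ hx.1
    have h4 := hlt _ hxs.1
    rw [hinner] at h2 h4
    exact abs_le.2 ⟨by linarith, by linarith⟩
  · gcongr
    exact (h.memLp_weakGrad hPΩ).2.ne

variable {G : E (k + 1) → E (k + 1)}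

/-- `χ * η j` is a test function of the cell although `η j` is not, so the identity for `η j` is the
product rule. Both sides are pairings with fixed `L²` functions and pass to the limit. -/
theorem ZeroTraceApprox.integral_cutoff (h : ZeroTraceApprox Ω P η z) (hPΩ : interior P ⊆ Ω)
    (hG : MemLp G 2 (volume.restrict (interior P)))
    (hdiv : ∀ θ, IsTestFun (interior P) θ → ∫ x in interior P, ⟪G x, ∇ θ x⟫ = 0)
    {χ : E (k + 1) → ℝ} (hχ : IsTestFun (interior P) χ) :
    ∫ x in interior P, χ x * ⟪G x, weakGrad Ω z x⟫ =
      -∫ x in interior P, ⟪G x, ∇ χ x⟫ * z x := by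
  obtain ⟨C₀, hC₀⟩ := hχ.smooth.continuous.bounded_above_of_compact_support hχ.compact
  obtain ⟨C₁, hC₁⟩ := hχ.gradient_continuous.bounded_above_of_compact_support
    (hasCompactSupport_gradient hχ.compact)
  have h0 : MemLp (fun x => χ x • G x) 2 (volume.restrict (interior P)) := by
    refine hG.of_le_mul (c := C₀)
      (hχ.smooth.continuous.aestronglyMeasurable.smul hG.1) (ae_of_all _ fun x => ?_)
    rw [norm_smul]
    gcongr
    exact hC₀ x
  have h1 : MemLp (fun x => ⟪G x, ∇ χ x⟫) 2 (volume.restrict (interior P)) := by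
    refine hG.of_le_mul (c := C₁)
      (hG.1.inner hχ.gradient_continuous.aestronglyMeasurable) (ae_of_all _ fun x => ?_)
    refine (norm_inner_le_norm _ _).trans ?_
    rw [mul_comm]
    gcongr
    exact hC₁ x
  have ht0 := tendsto_integral_inner h0 (fun j => (h.isTestFun j).memLp_gradient _)
    (h.memLp_weakGrad hPΩ) (h.tendsto_grad hPΩ)
  have ht1 := tendsto_integral_inner h1 (fun j => (h.isTestFun j).memLp _)
    (h.memLp hPΩ) (h.tendsto_value hPΩ)
  have hzero : ∀ j, (∫ x in interior P, ⟪χ x • G x, ∇ (η j) x⟫) +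
      ∫ x in interior P, ⟪⟪G x, ∇ χ x⟫, η j x⟫ = 0 := by
    intro j
    have hθ : IsTestFun (interior P) (χ * η j) := by
      refine ⟨hχ.smooth.mul (h.isTestFun j).smooth, hχ.compact.mul_right, ?_⟩
      exact (tsupport_mul_subset_left (f := χ) (g := η j)).trans hχ.support_subset
    rw [← integral_add (integrable_inner_of_memLp h0 ((h.isTestFun j).memLp_gradient _))
      (integrable_inner_of_memLp h1 ((h.isTestFun j).memLp _)), ← hdiv _ hθ]
    refine integral_congr_ae (ae_of_all _ fun x => ?_)
    simp only
    rw [gradient_mul (hχ.differentiable x) ((h.isTestFun j).differentiable x), inner_add_right,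
      real_inner_smul_left, real_inner_smul_right, real_inner_smul_right]
    simp
  have hlim := tendsto_nhds_unique ((ht0.add ht1).congr hzero) tendsto_const_nhds
  have e0 : ∫ x in interior P, χ x * ⟪G x, weakGrad Ω z x⟫ =
      ∫ x in interior P, ⟪χ x • G x, weakGrad Ω z x⟫ := by
    simp only [real_inner_smul_left]
  have e1 : ∫ x in interior P, ⟪G x, ∇ χ x⟫ * z x =
      ∫ x in interior P, ⟪⟪G x, ∇ χ x⟫, z x⟫ := by
    refine integral_congr_ae (ae_of_all _ fun x => ?_)
    simp [mul_comm]
  rw [e0, e1]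
  linarith

/-- Cauchy–Schwarz on each layer separately, so that each layer can be treated with its own normal;
overlaps do no harm. -/
theorem abs_integral_mul_le_sum {U : Set (E (k + 1))}
    (hG : MemLp G 2 (volume.restrict U)) (hz : MemLp z 2 (volume.restrict U))
    {χ : E (k + 1) → ℝ} {ι : Type*} {T : Finset ι} {S : ι → Set (E (k + 1))}
    (hS : ∀ p, MeasurableSet (S p)) {c : ℝ} (hc : 0 ≤ c)
    (hχ : ∀ x, ‖∇ χ x‖ ≤ ∑ p ∈ T, (S p).indicator (fun _ => c) x) :
    |∫ x in U, ⟪G x, ∇ χ x⟫ * z x| ≤ ∑ p ∈ T, c *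
      ((eLpNorm G 2 (volume.restrict (U ∩ S p))).toReal *
        (eLpNorm z 2 (volume.restrict (U ∩ S p))).toReal) := by
  have hint : Integrable (fun x => ‖G x‖ * ‖z x‖) (volume.restrict U) :=
    hG.norm.integrable_mul hz.norm
  have hle : ∀ x, ‖⟪G x, ∇ χ x⟫ * z x‖ ≤
      ∑ p ∈ T, (S p).indicator (fun x => c * (‖G x‖ * ‖z x‖)) x := by
    intro x
    calc ‖⟪G x, ∇ χ x⟫ * z x‖ ≤ (‖G x‖ * ‖∇ χ x‖) * ‖z x‖ := by
          rw [norm_mul]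
          gcongr
          exact norm_inner_le_norm _ _
      _ ≤ (‖G x‖ * ∑ p ∈ T, (S p).indicator (fun _ => c) x) * ‖z x‖ := by
          gcongr
          exact hχ x
      _ = _ := by
          rw [Finset.mul_sum, Finset.sum_mul]
          refine Finset.sum_congr rfl fun p _ => ?_
          by_cases hx : x ∈ S p
          · rw [Set.indicator_of_mem hx, Set.indicator_of_mem hx]; ring
          · rw [Set.indicator_of_notMem hx, Set.indicator_of_notMem hx]; ring
  have hintp : ∀ p ∈ T, Integrable ((S p).indicator (fun x => c * (‖G x‖ * ‖z x‖)))
      (volume.restrict U) := fun p _ => (hint.const_mul c).indicator (hS p)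
  rw [← Real.norm_eq_abs]
  refine (norm_integral_le_of_norm_le (integrable_finsetSum T hintp) (ae_of_all _ hle)).trans ?_
  rw [integral_finsetSum T hintp]
  refine Finset.sum_le_sum fun p _ => ?_
  have hsub : volume.restrict (U ∩ S p) ≤ volume.restrict U :=
    Measure.restrict_mono Set.inter_subset_left le_rfl
  rw [integral_indicator (hS p), Measure.restrict_restrict (hS p), Set.inter_comm,
    integral_const_mul]
  gcongr
  have := abs_integral_inner_le (hG.mono_measure hsub).norm (hz.mono_measure hsub).norm
  rw [eLpNorm_norm, eLpNorm_norm] at this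
  refine le_trans (le_of_eq ?_) ((le_abs_self _).trans this)
  refine integral_congr_ae (ae_of_all _ fun x => ?_)
  simp [mul_comm]

/-- A square-integrable field that is weakly divergence-free in `P` is orthogonal to the gradients
of functions with vanishing trace on the boundary of `P`. -/
theorem ZeroTraceApprox.integral_inner_weakGrad_eq_zero (h : ZeroTraceApprox Ω P η z)
    (hP : IsConvexPolytope P) (hPΩ : interior P ⊆ Ω)
    (hG : MemLp G 2 (volume.restrict (interior P)))
    (hdiv : ∀ θ, IsTestFun (interior P) θ → ∫ x in interior P, ⟪G x, ∇ θ x⟫ = 0) :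
    ∫ x in interior P, ⟪G x, weakGrad Ω z x⟫ = 0 := by
  obtain ⟨T, hT⟩ := hP.exists_halfspaceDescription
  obtain ⟨M, hM, hcut⟩ := hT.exists_cutoff hP
  have hε : ∀ j : ℕ, (0 : ℝ) < 1 / ((j : ℝ) + 1) := fun j => Nat.one_div_pos_of_nat
  choose χ hχ hχ01 hχ1 hχg using fun j : ℕ => hcut _ (hε j)
  set ε : ℕ → ℝ := fun j => 1 / ((j : ℝ) + 1) with hεdef
  have hεlim : Tendsto ε atTop (𝓝 0) := tendsto_one_div_add_atTop_nhds_zero_nat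
  have hεanti : Antitone ε := fun i j hij => Nat.one_div_le_one_div hij
  let S : ℕ → E (k + 1) × ℝ → Set (E (k + 1)) := fun j p => {x | p.2 - 2 * ε j ≤ ⟪p.1, x⟫}
  have hSm : ∀ j p, MeasurableSet (S j p) := fun j p =>
    (isClosed_le continuous_const (by fun_prop)).measurableSet
  set Z := (eLpNorm (weakGrad Ω z) 2 (volume.restrict (interior P))).toReal
  -- The layers decrease to the empty set inside the open polytope, so the norm of the fixed `L²`
  -- field `G` on them tends to zero.
  have hGK : ∀ p ∈ T, Tendsto
      (fun j => (eLpNorm G 2 (volume.restrict (interior P ∩ S j p))).toReal) atTop (𝓝 0) := by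
    intro p hp
    have hsq : Tendsto (fun j => ∫ x in interior P ∩ S j p, ‖G x‖ ^ 2) atTop (𝓝 0) := by
      have := tendsto_setIntegral_of_antitone (μ := volume) (f := fun x => ‖G x‖ ^ 2)
        (s := fun j => interior P ∩ S j p)
        (fun j => isOpen_interior.measurableSet.inter (hSm j p))
        (fun i j hij x hx => ⟨hx.1, by
          have h1 : p.2 - 2 * ε j ≤ ⟪p.1, x⟫ := hx.2
          have h2 := hεanti hij
          change p.2 - 2 * ε i ≤ ⟪p.1, x⟫
          linarith⟩)
        ⟨0, ((memLp_two_iff_integrable_sq_norm hG.1).1 hG).mono_measure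
          (Measure.restrict_mono Set.inter_subset_left le_rfl)⟩
      have hempty : ⋂ j, interior P ∩ S j p = ∅ := by
        refine Set.eq_empty_of_forall_notMem fun x hx => ?_
        rw [Set.mem_iInter] at hx
        have hlt : ⟪p.1, x⟫ < p.2 := by
          have := (hx 0).1
          rw [hT.interior_eq] at this
          exact this p hp
        have hlim : Tendsto (fun j => p.2 - 2 * ε j) atTop (𝓝 (p.2 - 2 * 0)) :=
          tendsto_const_nhds.sub (hεlim.const_mul 2)
        have := le_of_tendsto' hlim fun j => (hx j).2
        linarith
      rwa [hempty, setIntegral_empty] at this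
    have hs := hsq.sqrt
    rw [Real.sqrt_zero] at hs
    refine hs.congr fun j => ?_
    rw [← toReal_eLpNorm_two_sq (hG.mono_measure
      (Measure.restrict_mono Set.inter_subset_left le_rfl)), Real.sqrt_sq ENNReal.toReal_nonneg]
  -- The factor `M / ε` from the cutoff meets `2 * (2ε) * Z` from the layer of width `2ε`: the
  -- powers of `ε` cancel and `4 * M * Z` is left.
  have hbound : ∀ j, |∫ x in interior P, ⟪G x, ∇ (χ j) x⟫ * z x| ≤
      ∑ p ∈ T, 4 * M * Z * (eLpNorm G 2 (volume.restrict (interior P ∩ S j p))).toReal := by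
    intro j
    refine (abs_integral_mul_le_sum hG (h.memLp hPΩ) (hSm j)
      (div_nonneg hM (hε j).le) (hχg j)).trans (Finset.sum_le_sum fun p hp => ?_)
    have hlayer := h.layer hP hPΩ hT hp (δ := 2 * ε j) (mul_nonneg zero_le_two (hε j).le)
    have hεj : ε j ≠ 0 := (hε j).ne'
    have hεp : 0 < ε j := hε j
    calc M / ε j * ((eLpNorm G 2 (volume.restrict (interior P ∩ S j p))).toReal *
          (eLpNorm z 2 (volume.restrict (interior P ∩ S j p))).toReal)
        ≤ M / ε j * ((eLpNorm G 2 (volume.restrict (interior P ∩ S j p))).toReal *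
          (2 * (2 * ε j) * Z)) := by gcongr
      _ = _ := by field_simp; ring
  have hrhs : Tendsto (fun j => -∫ x in interior P, ⟪G x, ∇ (χ j) x⟫ * z x) atTop (𝓝 0) := by
    have hsum : Tendsto (fun j => ∑ p ∈ T, 4 * M * Z *
        (eLpNorm G 2 (volume.restrict (interior P ∩ S j p))).toReal) atTop (𝓝 0) := by
      have := tendsto_finsetSum T fun p hp => (hGK p hp).const_mul (4 * M * Z)
      simpa using this
    have := (squeeze_zero_norm (f := fun j => ∫ x in interior P, ⟪G x, ∇ (χ j) x⟫ * z x)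
      hbound hsum).neg
    rwa [neg_zero] at this
  have hlhs : Tendsto (fun j => ∫ x in interior P, χ j x * ⟪G x, weakGrad Ω z x⟫) atTop
      (𝓝 (∫ x in interior P, ⟪G x, weakGrad Ω z x⟫)) := by
    have hint := integrable_inner_of_memLp hG (h.memLp_weakGrad hPΩ)
    refine tendsto_integral_of_dominated_convergence (fun x => ‖⟪G x, weakGrad Ω z x⟫‖)
      (fun j => (hχ j).smooth.continuous.aestronglyMeasurable.mul hint.1) hint.norm
      (fun j => ae_of_all _ fun x => ?_) ?_
    · rw [norm_mul, Real.norm_of_nonneg (hχ01 j x).1]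
      exact mul_le_of_le_one_left (norm_nonneg _) (hχ01 j x).2
    · refine (ae_restrict_iff' isOpen_interior.measurableSet).2 (ae_of_all _ fun x hx => ?_)
      have hev : ∀ᶠ j in atTop, ∀ p ∈ T, 2 * ε j ≤ p.2 - ⟪p.1, x⟫ := by
        rw [Finset.eventually_all]
        intro p hp
        rw [hT.interior_eq] at hx
        have hlim : Tendsto (fun j => 2 * ε j) atTop (𝓝 (2 * 0)) := hεlim.const_mul 2
        exact (hlim.eventually_lt_const (by linarith [hx p hp])).mono fun j hj => hj.le
      refine tendsto_const_nhds.congr' (hev.mono fun j hj => ?_)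
      simp only [hχ1 j x hj, one_mul]
  refine tendsto_nhds_unique hlhs (hrhs.congr fun j => ?_)
  exact (h.integral_cutoff hPΩ hG hdiv (hχ j)).symm

end ZeroTrace

end MultiscaleFEM

namespace MultiscaleFEM

open scoped ENNReal

/-! ### Coarse meshes -/

section Mesh

variable {d N : ℕ} {P : Set (E d)} {D : Fin N → Set (E d)} {r : ℝ}

theorem IsCoarseMesh.interior_subset (hD : IsCoarseMesh P D r) (i : Fin N) :
    interior (D i) ⊆ interior P :=
  interior_mono (hD.iUnion_eq ▸ Set.subset_iUnion D i)

/-- Boundaries of convex sets are Lebesgue null, so the skeleton can be dropped from volume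
integrals. -/
theorem IsCoarseMesh.ae_eq (hD : IsCoarseMesh P D r) :
    interior P =ᵐ[volume] ⋃ i, interior (D i) := by
  refine Filter.EventuallyLE.antisymm ?_
    (LE.le.eventuallyLE (Set.iUnion_subset hD.interior_subset))
  have hnull : volume (⋃ i, frontier (D i)) = 0 :=
    measure_iUnion_null fun i => (hD.polytope i).convex.addHaar_frontier volume
  filter_upwards [measure_eq_zero_iff_ae_notMem.1 hnull] with x hx hxP
  have hxP' : x ∈ ⋃ i, D i := hD.iUnion_eq ▸ _root_.interior_subset hxP
  obtain ⟨i, hi⟩ := Set.mem_iUnion.1 hxP'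
  refine Set.mem_iUnion.2 ⟨i, ?_⟩
  by_contra hni
  exact hx (Set.mem_iUnion.2 ⟨i, subset_closure hi, hni⟩)

theorem IsCoarseMesh.setIntegral_eq_sum (hD : IsCoarseMesh P D r) {f : E d → ℝ}
    (hf : IntegrableOn f (interior P)) :
    ∫ x in interior P, f x = ∑ i, ∫ x in interior (D i), f x := by
  rw [setIntegral_congr_set hD.ae_eq]
  exact integral_iUnion_fintype (fun i => isOpen_interior.measurableSet) hD.disjoint
    fun i => hf.mono_set (hD.interior_subset i)

theorem IsCoarseMesh.toReal_eLpNorm_sq_eq_sum (hD : IsCoarseMesh P D r) {F : Type*}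
    [NormedAddCommGroup F] [InnerProductSpace ℝ F] {f : E d → F}
    (hf : MemLp f 2 (volume.restrict (interior P))) :
    (eLpNorm f 2 (volume.restrict (interior P))).toReal ^ 2 =
      ∑ i, (eLpNorm f 2 (volume.restrict (interior (D i)))).toReal ^ 2 := by
  rw [toReal_eLpNorm_two_sq hf,
    hD.setIntegral_eq_sum ((memLp_two_iff_integrable_sq_norm hf.1).1 hf)]
  exact Finset.sum_congr rfl fun i _ => (toReal_eLpNorm_two_sq
    (hf.mono_measure (Measure.restrict_mono (hD.interior_subset i) le_rfl))).symm

end Mesh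

/-! ### Traces -/

section Trace

variable {d : ℕ} {Ω Γ : Set (E d)} {v w : E d → ℝ} {g g' : Lp ℝ 2 (surfaceMeasure Γ)}

theorem isTrace_zero (hΩ : IsOpen Ω) : IsTrace Ω Γ 0 0 := by
  refine ⟨(h10 Ω hΩ).zero_mem, _, fun _ => isTestFun_zero, tendstoH1_zero hΩ, ?_⟩
  refine tendsto_const_nhds.congr fun _ => ((eLpNorm_congr_ae (g := 0) ?_).trans eLpNorm_zero).symm
  filter_upwards [Lp.coeFn_zero ℝ 2 (surfaceMeasure Γ)] with x hx
  rw [Pi.sub_apply, hx]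
  simp

theorem IsTrace.add (hΩ : IsOpen Ω) (h : IsTrace Ω Γ v g) (h' : IsTrace Ω Γ w g') :
    IsTrace Ω Γ (v + w) (g + g') := by
  obtain ⟨hv, η, hη, hηv, hηg⟩ := h
  obtain ⟨hw, θ, hθ, hθw, hθg⟩ := h'
  refine ⟨(h10 Ω hΩ).add_mem hv hw, _, fun k => (hη k).add (hθ k),
    hηv.add hΩ hv.memH1 hw.memH1 hη hθ hθw, ?_⟩
  refine (tendsto_eLpNorm_add
    (fun k => (hη k).smooth.continuous.aestronglyMeasurable.sub (Lp.aestronglyMeasurable g))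
    (fun k => (hθ k).smooth.continuous.aestronglyMeasurable.sub (Lp.aestronglyMeasurable g'))
    hηg hθg).congr fun k => eLpNorm_congr_ae ?_
  filter_upwards [Lp.coeFn_add g g'] with x hx
  simp only [Pi.add_apply, Pi.sub_apply, hx]
  ring

theorem IsTrace.const_smul (hΩ : IsOpen Ω) (h : IsTrace Ω Γ v g) (c : ℝ) :
    IsTrace Ω Γ (c • v) (c • g) := by
  obtain ⟨hv, η, hη, hηv, hηg⟩ := h
  refine ⟨(h10 Ω hΩ).smul_mem c hv, _, fun k => (hη k).const_smul c,
    hηv.const_smul hΩ hv.memH1 hη c, ?_⟩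
  refine (tendsto_eLpNorm_const_smul c hηg).congr fun k => eLpNorm_congr_ae ?_
  filter_upwards [Lp.coeFn_smul c g] with x hx
  simp only [Pi.smul_apply, Pi.sub_apply, hx, smul_sub]

theorem IsTrace.sub (hΩ : IsOpen Ω) (h : IsTrace Ω Γ v g) (h' : IsTrace Ω Γ w g') :
    IsTrace Ω Γ (v - w) (g - g') := by
  simpa [sub_eq_add_neg] using h.add hΩ (h'.const_smul hΩ (-1))

/-- Every element of the span of the traces is the trace of an element of the span. -/
theorem exists_isTrace_of_mem_traceSpan (hΩ : IsOpen Ω) {m : ℕ} {ψ : Fin m → E d → ℝ}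
    (hg : g ∈ traceSpan Ω Γ ψ) : ∃ v ∈ Submodule.span ℝ (Set.range ψ), IsTrace Ω Γ v g := by
  induction hg using Submodule.span_induction with
  | mem g hg =>
    obtain ⟨i, hi⟩ := hg
    exact ⟨ψ i, Submodule.subset_span ⟨i, rfl⟩, hi⟩
  | zero => exact ⟨0, Submodule.zero_mem _, isTrace_zero hΩ⟩
  | add g g' _ _ h h' =>
    obtain ⟨v, hv, hvg⟩ := h
    obtain ⟨w, hw, hwg⟩ := h'
    exact ⟨v + w, Submodule.add_mem _ hv hw, hvg.add hΩ hwg⟩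
  | smul c g _ h =>
    obtain ⟨v, hv, hvg⟩ := h
    exact ⟨c • v, Submodule.smul_mem _ c hv, hvg.const_smul hΩ c⟩

/-- If all generators have traces, so do the elements of their span. -/
theorem exists_mem_traceSpan_isTrace (hΩ : IsOpen Ω) {m : ℕ} {ψ : Fin m → E d → ℝ}
    (hψ : ∀ i, ∃ g, IsTrace Ω Γ (ψ i) g) (hv : v ∈ Submodule.span ℝ (Set.range ψ)) :
    ∃ g ∈ traceSpan Ω Γ ψ, IsTrace Ω Γ v g := by
  induction hv using Submodule.span_induction with
  | mem v hv =>
    obtain ⟨i, rfl⟩ := hv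
    obtain ⟨g, hg⟩ := hψ i
    exact ⟨g, Submodule.subset_span ⟨i, hg⟩, hg⟩
  | zero => exact ⟨0, Submodule.zero_mem _, isTrace_zero hΩ⟩
  | add v w _ _ h h' =>
    obtain ⟨g, hg, hvg⟩ := h
    obtain ⟨g', hg', hwg⟩ := h'
    exact ⟨g + g', Submodule.add_mem _ hg hg', hvg.add hΩ hwg⟩
  | smul c v _ h =>
    obtain ⟨g, hg, hvg⟩ := h
    exact ⟨c • g, Submodule.smul_mem _ c hg, hvg.const_smul hΩ c⟩

theorem surfaceMeasure_succ {k : ℕ} (Γ : Set (E (k + 1))) :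
    surfaceMeasure Γ = (Measure.hausdorffMeasure k).restrict Γ := by
  simp [surfaceMeasure]

/-- The trace inequality on the skeleton of a family of polytopes. -/
theorem exists_eLpNorm_skeleton_le {k N : ℕ} (Ω : Set (E (k + 1))) {D : Fin N → Set (E (k + 1))}
    (hD : ∀ i, IsConvexPolytope (D i)) :
    ∃ A : ℝ≥0∞, A ≠ ⊤ ∧ ∀ η, IsTestFun Ω η →
      eLpNorm η 2 (surfaceMeasure (skeleton D)) ≤
        A * (eLpNorm η 2 (volume.restrict Ω) + eLpNorm (∇ η) 2 (volume.restrict Ω)) := by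
  choose A hA hineq using fun i => exists_setLIntegral_frontier_le (hD i)
  -- The `1` ensures `B ≤ (B + 1)²`, so the inequality between squares gives one between norms
  -- without taking the root of `B`.
  refine ⟨∑ i, A i + 1, ENNReal.add_ne_top.2
    ⟨ENNReal.sum_ne_top.2 fun i _ => hA i, ENNReal.one_ne_top⟩, fun η hη => ?_⟩
  set B := ∑ i, A i
  have hs0 : Function.support η ⊆ Ω := (subset_tsupport η).trans hη.support_subset
  have hs1 : Function.support (∇ η) ⊆ Ω := support_gradient_subset.trans hη.support_subset
  rw [eLpNorm_restrict_eq_of_support_subset hs0, eLpNorm_restrict_eq_of_support_subset hs1]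
  set b := eLpNorm η 2 (volume : Measure (E (k + 1)))
  set c := eLpNorm (∇ η) 2 (volume : Measure (E (k + 1)))
  have hm : Measurable fun x => ‖η x‖ₑ ^ 2 :=
    (hη.smooth.continuous.enorm.measurable).pow_const 2
  have hsq : eLpNorm η 2 (surfaceMeasure (skeleton D)) ^ 2 ≤ B * (b ^ 2 + c ^ 2) := by
    rw [eLpNorm_two_sq, surfaceMeasure_succ, skeleton, eLpNorm_two_sq, eLpNorm_two_sq,
      ← lintegral_add_left hm, Finset.sum_mul]
    refine (lintegral_iUnion_le _ _).trans ?_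
    rw [tsum_fintype]
    exact Finset.sum_le_sum fun i _ => hineq i η hη.contDiff_one hη.compact
  have hB : B ≤ (B + 1) ^ 2 := by
    calc B ≤ B ^ 2 + 2 * B + 1 := by
          rw [two_mul, ← add_assoc, add_right_comm (B ^ 2 + B)]
          exact le_add_self
      _ = (B + 1) ^ 2 := by ring
  have hbc : b ^ 2 + c ^ 2 ≤ (b + c) ^ 2 := by
    calc b ^ 2 + c ^ 2 ≤ b ^ 2 + c ^ 2 + 2 * b * c := le_self_add
      _ = (b + c) ^ 2 := by ring
  refine (ENNReal.pow_le_pow_left_iff two_ne_zero).1 ?_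
  rw [mul_pow]
  exact hsq.trans (mul_le_mul' hB hbc)

/-- Functions in `H¹₀(Ω)` have a trace on the skeleton of a family of polytopes. -/
theorem exists_isTrace {k N : ℕ} {Ω : Set (E (k + 1))}
    {D : Fin N → Set (E (k + 1))} (hD : ∀ i, IsConvexPolytope (D i)) {w : E (k + 1) → ℝ}
    (hw : MemH10 Ω w) : ∃ g, IsTrace Ω (skeleton D) w g := by
  obtain ⟨A, hA, hineq⟩ := exists_eLpNorm_skeleton_le Ω hD
  obtain ⟨η, hη, hηw⟩ := hw.approx
  set μ := surfaceMeasure (skeleton D)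
  have hL : ∀ j, MemLp (η j) 2 μ := fun j =>
    ⟨(hη j).smooth.continuous.aestronglyMeasurable, (hineq _ (hη j)).trans_lt
      (ENNReal.mul_lt_top hA.lt_top
        (ENNReal.add_lt_top.2 ⟨((hη j).memLp Ω).2, ((hη j).memLp_gradient Ω).2⟩))⟩
  -- The trace inequality for differences makes the restrictions a Cauchy sequence in `L²` of the
  -- skeleton; its limit is the trace.
  have hsub : ∀ i j, eLpNorm (η i - η j) 2 μ ≤
      A * ((eLpNorm (η i - w) 2 (volume.restrict Ω) + eLpNorm (η j - w) 2 (volume.restrict Ω)) +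
        (eLpNorm (∇ (η i) - weakGrad Ω w) 2 (volume.restrict Ω) +
          eLpNorm (∇ (η j) - weakGrad Ω w) 2 (volume.restrict Ω))) := by
    intro i j
    have hθ : IsTestFun Ω (η i - η j) := by
      simpa [sub_eq_add_neg] using (hη i).add ((hη j).const_smul (-1))
    have hgrad : ∇ (η i - η j) = ∇ (η i) - ∇ (η j) := by
      have := (hη i).gradient_add ((hη j).const_smul (-1))
      rw [(hη j).gradient_const_smul] at this
      simpa [sub_eq_add_neg] using this
    refine (hineq _ hθ).trans ?_
    gcongr
    · have := eLpNorm_sub_le (((hη i).memLp Ω).sub hw.memH1.memLp).1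
        (((hη j).memLp Ω).sub hw.memH1.memLp).1 one_le_two
      rwa [sub_sub_sub_cancel_right] at this
    · have := eLpNorm_sub_le (((hη i).memLp_gradient Ω).sub hw.memH1.memLp_weakGrad).1
        (((hη j).memLp_gradient Ω).sub hw.memH1.memLp_weakGrad).1 one_le_two
      rw [hgrad]
      rwa [sub_sub_sub_cancel_right] at this
  have hcauchy : CauchySeq fun j => (hL j).toLp (η j) := by
    rw [Lp.cauchySeq_Lp_iff_cauchySeq_eLpNorm]
    have hlim : Tendsto (fun q : ℕ × ℕ =>
        A * ((eLpNorm (η q.1 - w) 2 (volume.restrict Ω) +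
            eLpNorm (η q.2 - w) 2 (volume.restrict Ω)) +
          (eLpNorm (∇ (η q.1) - weakGrad Ω w) 2 (volume.restrict Ω) +
            eLpNorm (∇ (η q.2) - weakGrad Ω w) 2 (volume.restrict Ω)))) atTop (𝓝 0) := by
      have h1 : Tendsto (fun q : ℕ × ℕ => q.1) atTop atTop := by
        rw [← prod_atTop_atTop_eq]; exact tendsto_fst
      have h2 : Tendsto (fun q : ℕ × ℕ => q.2) atTop atTop := by
        rw [← prod_atTop_atTop_eq]; exact tendsto_snd
      have := ENNReal.Tendsto.const_mul (a := A)
        (((hηw.value.comp h1).add (hηw.value.comp h2)).add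
          ((hηw.grad.comp h1).add (hηw.grad.comp h2))) (Or.inr hA)
      simpa using this
    refine tendsto_of_tendsto_of_tendsto_of_le_of_le tendsto_const_nhds hlim
      (fun _ => zero_le) fun q => ?_
    refine (eLpNorm_congr_ae ?_).trans_le (hsub q.1 q.2)
    exact (hL q.1).coeFn_toLp.sub (hL q.2).coeFn_toLp
  obtain ⟨g, hg⟩ := cauchySeq_tendsto_of_complete hcauchy
  refine ⟨g, hw, η, hη, hηw, ?_⟩
  refine ((Lp.tendsto_Lp_iff_tendsto_eLpNorm' _ _).1 hg).congr fun j => eLpNorm_congr_ae ?_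
  exact (hL j).coeFn_toLp.sub (ae_eq_refl _)

theorem IsTrace.exists_zeroTraceApprox {k N : ℕ} {Ω : Set (E (k + 1))}
    {D : Fin N → Set (E (k + 1))} {z : E (k + 1) → ℝ} (hz : IsTrace Ω (skeleton D) z 0) :
    ∃ η, ∀ i, ZeroTraceApprox Ω (D i) η z := by
  obtain ⟨hz, η, hη, hηz, htr⟩ := hz
  refine ⟨η, fun i => ⟨hz.memH1, hη, hηz, ?_⟩⟩
  have h0 : Tendsto (fun j => eLpNorm (η j) 2 (surfaceMeasure (skeleton D)) ^ 2) atTop (𝓝 0) := by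
    have h1 : Tendsto (fun j => eLpNorm (η j) 2 (surfaceMeasure (skeleton D))) atTop (𝓝 0) := by
      refine htr.congr fun j => eLpNorm_congr_ae ?_
      filter_upwards [Lp.coeFn_zero ℝ 2 (surfaceMeasure (skeleton D))] with x hx
      rw [Pi.sub_apply, hx, Pi.zero_apply, sub_zero]
    simpa using ENNReal.Tendsto.pow (n := 2) h1
  refine tendsto_of_tendsto_of_tendsto_of_le_of_le tendsto_const_nhds h0
    (fun _ => zero_le) fun j => ?_
  rw [eLpNorm_two_sq, surfaceMeasure_succ]
  exact lintegral_mono_set (Set.subset_iUnion (fun i => frontier (D i)) i)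

end Trace

/-! ### Functions with vanishing trace on the skeleton -/

section ZeroTraceSkeleton

variable {k N : ℕ} {P : Set (E (k + 1))} {D : Fin N → Set (E (k + 1))} {r lmin lmax : ℝ}
  {a φ z : E (k + 1) → ℝ}

/-- Poincaré on each cell, squared and summed; the cell diameter gives the power of the mesh size in
the error. -/
theorem IsTrace.toReal_eLpNorm_le (hD : IsCoarseMesh P D r) (hr : 0 ≤ r)
    (hz : IsTrace (interior P) (skeleton D) z 0) :
    (eLpNorm z 2 (volume.restrict (interior P))).toReal ≤
      2 * r * (eLpNorm (weakGrad (interior P) z) 2 (volume.restrict (interior P))).toReal := by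
  obtain ⟨η, hη⟩ := hz.exists_zeroTraceApprox
  have hz1 := hz.1.memH1
  refine abs_le_of_sq_le_sq' ?_ (by positivity) |>.2
  rw [mul_pow, hD.toReal_eLpNorm_sq_eq_sum hz1.memLp,
    hD.toReal_eLpNorm_sq_eq_sum hz1.memLp_weakGrad, Finset.mul_sum]
  refine Finset.sum_le_sum fun i _ => ?_
  rw [← mul_pow]
  gcongr
  exact (hη i).poincare (hD.polytope i) (hD.interior_subset i) (hD.diam_le i)

/-- Multi-scale functions are energy-orthogonal to functions with vanishing trace on the
skeleton. -/
theorem IsMultiscale.energyForm_eq_zero (hD : IsCoarseMesh P D r)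
    (ha : IsCoefficient (interior P) lmin lmax a) (hφ : IsMultiscale (interior P) a D φ)
    (hz : IsTrace (interior P) (skeleton D) z 0) : energyForm (interior P) a φ z = 0 := by
  obtain ⟨η, hη⟩ := hz.exists_zeroTraceApprox
  have hG := ha.memLp_smul hφ.memH10.memH1.memLp_weakGrad
  rw [energyForm_eq_inner_smul,
    hD.setIntegral_eq_sum (integrable_inner_of_memLp hG hz.1.memH1.memLp_weakGrad)]
  refine Finset.sum_eq_zero fun i _ => ?_
  refine (hη i).integral_inner_weakGrad_eq_zero (hD.polytope i) (hD.interior_subset i)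
    (hG.mono_measure (Measure.restrict_mono (hD.interior_subset i) le_rfl)) fun θ hθ => ?_
  simp only [real_inner_smul_left]
  exact hφ.harmonic i θ hθ

theorem energyForm_eq_zero_of_mem_span (hD : IsCoarseMesh P D r)
    (ha : IsCoefficient (interior P) lmin lmax a) {n : ℕ} {φ : Fin n → E (k + 1) → ℝ}
    (hφ : ∀ i, IsMultiscale (interior P) a D (φ i))
    (hz : IsTrace (interior P) (skeleton D) z 0) {v : E (k + 1) → ℝ}
    (hv : v ∈ Submodule.span ℝ (Set.range φ)) : energyForm (interior P) a z v = 0 := by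
  have hle : Submodule.span ℝ (Set.range φ) ≤ h10 (interior P) isOpen_interior :=
    Submodule.span_le.2 (by rintro _ ⟨i, rfl⟩; exact (hφ i).memH10)
  have hz1 := hz.1.memH1
  induction hv using Submodule.span_induction with
  | mem v hv =>
    obtain ⟨i, rfl⟩ := hv
    rw [energyForm_comm]
    exact (hφ i).energyForm_eq_zero hD ha hz
  | zero =>
    have := energyForm_smul_right (a := a) (u := z) isOpen_interior
      (memH1_zero (U := interior P)) 0
    rwa [smul_zero, zero_mul] at this
  | add v w hv hw h h' =>
    rw [energyForm_add_right isOpen_interior ha hz1 (hle hv).memH1 (hle hw).memH1, h, h', add_zero]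
  | smul c v hv h => rw [energyForm_smul_right isOpen_interior (hle hv).memH1, h, mul_zero]

end ZeroTraceSkeleton

/-! ### Error estimates -/

section Error

/-- Céa's lemma for the energy form: a Galerkin solution is the best approximation. -/
theorem IsGalerkinSolution.energyForm_error_le {d n : ℕ} {Ω : Set (E d)} {lmin lmax : ℝ}
    {a f u uh v : E d → ℝ} {φ : Fin n → E d → ℝ} (hΩ : IsOpen Ω) (hmin : 0 ≤ lmin)
    (ha : IsCoefficient Ω lmin lmax a) (hu : IsWeakSolution Ω a f u)
    (hφ : ∀ i, MemH10 Ω (φ i)) (huh : IsGalerkinSolution Ω a f φ uh)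
    (hv : v ∈ Submodule.span ℝ (Set.range φ)) :
    energyForm Ω a (u - uh) (u - uh) ≤ energyForm Ω a (u - v) (u - v) := by
  have hle : Submodule.span ℝ (Set.range φ) ≤ h10 Ω hΩ :=
    Submodule.span_le.2 (by rintro _ ⟨i, rfl⟩; exact hφ i)
  have hu1 := hu.memH10.memH1
  have huh1 := (hle huh.mem_span).memH1
  have hw : uh - v ∈ Submodule.span ℝ (Set.range φ) := Submodule.sub_mem _ huh.mem_span hv
  have hw1 := (hle hw).memH1
  have he1 := hu1.sub huh1
  have horth : energyForm Ω a (u - uh) (uh - v) = 0 := by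
    rw [energyForm_sub_left hΩ ha hw1 hu1 huh1, hu.weak_form _ (hle hw), huh.galerkin _ hw,
      sub_self]
  have hsplit : u - v = (u - uh) + (uh - v) := by abel
  rw [hsplit, energyForm_add_self hΩ ha he1 hw1, horth]
  have := energyForm_self_nonneg hmin ha hw1
  linarith

variable {k N : ℕ} {P : Set (E (k + 1))} {D : Fin N → Set (E (k + 1))} {r lmin lmax : ℝ}
  {a f u uh uMS v : E (k + 1) → ℝ}

/-- Replacing an approximation by an energy-orthogonal projection with the same trace on the
skeleton costs at most the local error on the coarse elements. -/
theorem IsTrace.energyForm_error_le (hD : IsCoarseMesh P D r) (hr : 0 ≤ r) (hmin : 0 < lmin)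
    (ha : IsCoefficient (interior P) lmin lmax a)
    (hf : MemLp f 2 (volume.restrict (interior P))) (hu : IsWeakSolution (interior P) a f u)
    (huh : MemH1 (interior P) uh) (hv : MemH1 (interior P) v)
    (hz : IsTrace (interior P) (skeleton D) (uh - v) 0)
    (horth : energyForm (interior P) a (uh - v) v = 0) :
    energyForm (interior P) a (u - v) (u - v) ≤ energyForm (interior P) a (u - uh) (u - uh) +
      4 * r ^ 2 / lmin * l2Norm (interior P) f ^ 2 := by
  have hΩ : IsOpen (interior P) := isOpen_interior
  have hu1 := hu.memH10.memH1
  obtain ⟨z, hzdef⟩ : ∃ z, z = uh - v := ⟨_, rfl⟩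
  rw [← hzdef] at hz horth
  have hz1 := hz.1.memH1
  have he1 := hu1.sub huh
  have hsplit : u - v = (u - uh) + z := by rw [hzdef]; abel
  have huhz : uh = z + v := by rw [hzdef]; abel
  have h1 : energyForm (interior P) a z uh = energyForm (interior P) a z z := by
    conv_lhs => rw [huhz]
    rw [energyForm_add_right hΩ ha hz1 hz1 hv, horth, add_zero]
  have h2 : energyForm (interior P) a z (u - uh) =
      (∫ x in interior P, f x * z x) - energyForm (interior P) a z z := by
    rw [energyForm_sub_right hΩ ha hz1 hu1 huh, h1, energyForm_comm, hu.weak_form z hz.1]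
  -- The cross term contributes `-2 a(z, z)`, turning the `+a(z, z)` of the square into the negative
  -- term that Young's inequality needs.
  have hexp : energyForm (interior P) a (u - v) (u - v) =
      energyForm (interior P) a (u - uh) (u - uh) + 2 * (∫ x in interior P, f x * z x) -
        energyForm (interior P) a z z := by
    rw [hsplit, energyForm_add_self hΩ ha he1 hz1, energyForm_comm (u := u - uh) (v := z), h2]
    ring
  have hcs : ∫ x in interior P, f x * z x ≤
      l2Norm (interior P) f * (eLpNorm z 2 (volume.restrict (interior P))).toReal := by
    refine le_trans (le_of_eq ?_) ((le_abs_self _).trans (abs_integral_inner_le hf hz1.memLp))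
    refine integral_congr_ae (ae_of_all _ fun x => ?_)
    simp [mul_comm]
  have hpoin := hz.toReal_eLpNorm_le hD hr
  have hcoer := energyForm_self_ge ha hz1
  set t := (eLpNorm (weakGrad (interior P) z) 2 (volume.restrict (interior P))).toReal
  set F := l2Norm (interior P) f
  have hF : 0 ≤ F := ENNReal.toReal_nonneg
  have hcs' : ∫ x in interior P, f x * z x ≤ F * (2 * r * t) :=
    hcs.trans (mul_le_mul_of_nonneg_left hpoin hF)
  -- Completing the square in `t`.
  have hyoung : 2 * (F * (2 * r * t)) - lmin * t ^ 2 ≤ 4 * r ^ 2 / lmin * F ^ 2 := by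
    have : 4 * r ^ 2 / lmin * F ^ 2 - (2 * (F * (2 * r * t)) - lmin * t ^ 2) =
        (2 * r * F - lmin * t) ^ 2 / lmin := by
      field_simp
      ring
    have h0 : 0 ≤ (2 * r * F - lmin * t) ^ 2 / lmin := by positivity
    linarith
  rw [hexp]
  linarith

end Error

end MultiscaleFEM

/-! ### The two error estimates. -/

theorem proposition3p1 (d : ℕ) (hd : d = 2 ∨ d = 3)
    (lmin lmax κ : ℝ) (hlmin : 0 < lmin) (hl : lmin ≤ lmax) (hκ : 0 < κ) :
    ∃ C : ℝ, 0 < C ∧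
      ∀ (P : Set (MultiscaleFEM.E d)), MultiscaleFEM.IsConvexPolytope P →
      ∀ (a : MultiscaleFEM.E d → ℝ), MultiscaleFEM.IsCoefficient (interior P) lmin lmax a →
      ∀ (H : ℝ), 0 < H →
      ∀ (N : ℕ) (D : Fin N → Set (MultiscaleFEM.E d)), MultiscaleFEM.IsCoarseMesh P D (κ * H) →
      ∀ (m n : ℕ) (ψ : Fin m → MultiscaleFEM.E d → ℝ) (φ : Fin n → MultiscaleFEM.E d → ℝ),
        (∀ i, MultiscaleFEM.MemH10 (interior P) (ψ i)) →
        (∀ i, MultiscaleFEM.IsMultiscale (interior P) a D (φ i)) →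
        MultiscaleFEM.traceSpan (interior P) (MultiscaleFEM.skeleton D) φ =
          MultiscaleFEM.traceSpan (interior P) (MultiscaleFEM.skeleton D) ψ →
      ∀ (f u uh uMS : MultiscaleFEM.E d → ℝ),
        MemLp f 2 (volume.restrict (interior P)) →
        MultiscaleFEM.IsWeakSolution (interior P) a f u →
        MultiscaleFEM.IsGalerkinSolution (interior P) a f ψ uh →
        MultiscaleFEM.IsGalerkinSolution (interior P) a f φ uMS →
        MultiscaleFEM.energyNorm (interior P) a (u - uMS) ^ 2 ≤
            MultiscaleFEM.energyNorm (interior P) a (u - uh) ^ 2 +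
              C * MultiscaleFEM.l2Norm (interior P) f ^ 2 * H ^ 2 ∧
        MultiscaleFEM.energyNorm (interior P) a (u - uMS) ≤
            MultiscaleFEM.energyNorm (interior P) a (u - uh) +
              C * MultiscaleFEM.l2Norm (interior P) f * H := by
  obtain ⟨k, rfl⟩ : ∃ k, d = k + 1 := by
    rcases hd with rfl | rfl
    exacts [⟨1, rfl⟩, ⟨2, rfl⟩]
  -- Chosen so that `c² H²` is the local error constant `4 r² / lmin` at `r = κ * H`. The squared
  -- estimate needs `c²` and the unsquared one `c`; their sum serves for both.
  set c := 2 * κ / √lmin with hc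
  have hsqrt : 0 < √lmin := Real.sqrt_pos.2 hlmin
  have hc0 : 0 < c := by positivity
  have hc2 : c ^ 2 = 4 * κ ^ 2 / lmin := by
    rw [hc, div_pow, Real.sq_sqrt hlmin.le]
    ring
  refine ⟨c ^ 2 + c, by positivity, ?_⟩
  intro P hP a ha H hH N D hD m n ψ φ hψ hφ hspan f u uh uMS hf hu huh huMS
  have hΩ : IsOpen (interior P) := isOpen_interior
  have hψle : Submodule.span ℝ (Set.range ψ) ≤ MultiscaleFEM.h10 (interior P) hΩ :=
    Submodule.span_le.2 (by rintro _ ⟨i, rfl⟩; exact hψ i)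
  have hφle : Submodule.span ℝ (Set.range φ) ≤ MultiscaleFEM.h10 (interior P) hΩ :=
    Submodule.span_le.2 (by rintro _ ⟨i, rfl⟩; exact (hφ i).memH10)
  have hr : 0 ≤ κ * H := by positivity
  -- `traceSpan` collects only traces that exist, so their existence for the `ψ i` is needed to
  -- place the trace of `uh` in it. Equality of spans then yields a multi-scale `v` with that trace.
  obtain ⟨g, hg, huhg⟩ := MultiscaleFEM.exists_mem_traceSpan_isTrace hΩ
    (fun i => MultiscaleFEM.exists_isTrace hD.polytope (hψ i)) huh.mem_span
  obtain ⟨v, hv, hvg⟩ := MultiscaleFEM.exists_isTrace_of_mem_traceSpan hΩ (hspan ▸ hg)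
  have hz : MultiscaleFEM.IsTrace (interior P) (MultiscaleFEM.skeleton D) (uh - v) 0 :=
    sub_self g ▸ huhg.sub hΩ hvg
  have huh1 := (hψle huh.mem_span).memH1
  have hu1 := hu.memH10.memH1
  have huMS1 := (hφle huMS.mem_span).memH1
  have hcea := huMS.energyForm_error_le hΩ hlmin.le ha hu (fun i => (hφ i).memH10) hv
  have herr := hz.energyForm_error_le hD hr hlmin ha hf hu huh1 (hφle hv).memH1
    (MultiscaleFEM.energyForm_eq_zero_of_mem_span hD ha hφ hz hv)
  have hle := hcea.trans herr
  rw [← MultiscaleFEM.energyNorm_sq hlmin.le ha (hu1.sub huMS1),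
    ← MultiscaleFEM.energyNorm_sq hlmin.le ha (hu1.sub huh1)] at hle
  have hX : 0 ≤ MultiscaleFEM.energyNorm (interior P) a (u - uh) := Real.sqrt_nonneg _
  have hF : 0 ≤ MultiscaleFEM.l2Norm (interior P) f := ENNReal.toReal_nonneg
  set X := MultiscaleFEM.energyNorm (interior P) a (u - uh)
  set Y := MultiscaleFEM.energyNorm (interior P) a (u - uMS)
  set F := MultiscaleFEM.l2Norm (interior P) f
  have hle' : Y ^ 2 ≤ X ^ 2 + (c * F * H) ^ 2 := by
    refine hle.trans_eq ?_
    have h : (c * F * H) ^ 2 = c ^ 2 * F ^ 2 * H ^ 2 := by ring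
    rw [h, hc2]
    ring
  constructor
  · have : 0 ≤ c * (F ^ 2 * H ^ 2) := by positivity
    linarith
  · have h1 : Y ≤ X + c * F * H := by
      -- `X² + (cFH)² ≤ (X + cFH)²`, as the cross term is nonnegative.
      refine abs_le_of_sq_le_sq' ?_ (by positivity) |>.2
      have : 0 ≤ X * (c * F * H) := by positivity
      linarith
    have h2 : 0 ≤ c ^ 2 * (F * H) := by positivity
    linarith
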